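/- Let $n>4$. Let $A(\Delta_n)$ be the Artin group of the $n$-gon $\Delta_n$ (affine type $\tilde A_{n-1}$), i.e. the group with generators $a_1,\dots,a_n$ and relations $a_ia_ja_i=a_ja_ia_j$ if $i,j$ are cyclically adjacent modulo $n$, and $a_ia_j=a_ja_i$ for all other pairs $i\neq j$. Let $\sigma:A(\Delta_n)\to\mathrm{Sym}(n)$ be the homomorphism with $\sigma(a_i)=(i,i+1)$ for $1\le i<n$ and $\sigma(a_n)=(1,n)$, and let $H\le A(\Delta_n)$ be the preimage under $\sigma$ of the stabiliser in $\mathrm{Sym}(n)$ of the unordered pair $\{1,2\}$. Let $G_0$ be the quotient of $A(\Delta_n)$ by the normal closure of the cycle commutator \[[a_1,\;v a_n v^{-1}],\qquad v=a_2a_3\cdots a_{n-1},\] and, for $1\le t\le n-3$, let $G_t$ be the quotient of $A(\Delta_n)$ by the normal closure of the $t$-twisted cycle commutator \[[a_1,\;v_t a_n v_t^{-1}],\qquad v_t=a_2^{-1}\cdots a_{t+1}^{-1}\,a_{t+2}\cdots a_{n-1},\] where $[g,h]=ghg^{-1}h^{-1}$. Let $H_0\le G_0$ and $H_t\le G_t$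 be the images of $H$. Then \[H/[H,H]\cong\mathbb Z^4,\qquad H_0/[H_0,H_0]\cong \mathbb Z/2\mathbb Z\oplus\mathbb Z^3,\] and, for every $t$ with $1\le t\le n-3$, \[H_t/[H_t,H_t]\cong \mathbb Z/2\mathbb Z\oplus\mathbb Z/4\mathbb Z\oplus\mathbb Z^2 .\] -/

import Mathlib

open scoped Pointwise commutatorElement

namespace PolygonArtin

section Artin

variable {V : Type*}

/-- Defining relators of the Artin group of a simply laced diagram: generators at adjacent
vertices braid, generators at distinct non-adjacent vertices commute. -/
def artinRelators (Γ : SimpleGraph V) : Set (FreeGroup V) :=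
  {r | ∃ i j, Γ.Adj i j ∧
    r = FreeGroup.of i * FreeGroup.of j * FreeGroup.of i *
      (FreeGroup.of j * FreeGroup.of i * FreeGroup.of j)⁻¹} ∪
  {r | ∃ i j, i ≠ j ∧ ¬ Γ.Adj i j ∧
    r = FreeGroup.of i * FreeGroup.of j * (FreeGroup.of j * FreeGroup.of i)⁻¹}

/-- The Artin group `A(Γ)` of a simply laced diagram `Γ`. -/
abbrev ArtinGroup (Γ : SimpleGraph V) : Type _ := PresentedGroup (artinRelators Γ)

end Artin

section Commutators

variable {G : Type*} [Group G]

/-- The cycle commutator `[y₁, y₂ ⋯ yₙ₋₁ yₙ yₙ₋₁⁻¹ ⋯ y₂⁻¹]` of `y₁, …, yₙ`. -/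
def cycleCommutator (n : ℕ) (y : ℕ → G) : G :=
  let v := ((List.Ico 2 n).map y).prod
  ⁅y 1, v * y n * v⁻¹⁆

/-- The `t`-twisted cycle commutator
`[y₁, y₂⁻¹ ⋯ yₜ₊₁⁻¹ yₜ₊₂ ⋯ yₙ₋₁ yₙ yₙ₋₁⁻¹ ⋯ yₜ₊₂⁻¹ yₜ₊₁ ⋯ y₂]` of `y₁, …, yₙ`,
meant for `1 ≤ t ≤ n - 2`. -/
def twistedCycleCommutator (n t : ℕ) (y : ℕ → G) : G :=
  let v := ((List.Ico 2 (t + 2)).map fun i => (y i)⁻¹).prod * ((List.Ico (t + 2) n).map y).prod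
  ⁅y 1, v * y n * v⁻¹⁆

end Commutators

/-! The vertices `1, …, n` of the `n`-gon are read modulo `n`, as elements of `Fin n`,
so that vertex `n` is `0 : Fin n`. -/

section Polygon

variable (n : ℕ) [NeZero n]

/-- The Artin group `A(Δₙ)` of the `n`-gon. -/
abbrev PolygonGroup : Type := ArtinGroup (SimpleGraph.cycleGraph n)

/-- The standard generator `aᵢ` of `A(Δₙ)`; the index is read modulo `n`. -/
def a (i : ℕ) : PolygonGroup n := PresentedGroup.of (Fin.ofNat n i)

/-- The transposition `(i, i + 1)` in the symmetric group on the vertices; for the vertex `n` this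
is the transposition `(1, n)`. -/
def transposition (i : Fin n) : Equiv.Perm (Fin n) := Equiv.swap i (i + 1)

theorem transposition_braid {i : Fin n} :
    transposition n i * transposition n (i + 1) * transposition n i =
      transposition n (i + 1) * transposition n i * transposition n (i + 1) := by
  unfold transposition
  have h : i = i + 1 ↔ i + 1 = i + 1 + 1 := add_left_inj (1 : Fin n) |>.symm
  generalize i + 1 + 1 = k at h ⊢
  generalize i + 1 = j at h ⊢
  ext x
  simp only [Equiv.Perm.mul_apply, Equiv.swap_apply_def]
  grind

theorem transposition_comm {i j : Fin n} (h1 : j ≠ i + 1) (h2 : i ≠ j + 1) :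
    transposition n i * transposition n j = transposition n j * transposition n i := by
  unfold transposition
  have h : i = j ↔ i + 1 = j + 1 := add_left_inj (1 : Fin n) |>.symm
  generalize i + 1 = k at h h1 ⊢
  generalize j + 1 = l at h h2 ⊢
  ext x
  simp only [Equiv.Perm.mul_apply, Equiv.swap_apply_def]
  grind

theorem cycleGraph_adj_iff {i j : Fin n} :
    (SimpleGraph.cycleGraph n).Adj i j ↔ i ≠ j ∧ (j = i + 1 ∨ i = j + 1) := by
  obtain _ | _ | m := n
  · exact i.elim0
  · have hij : i = j := Fin.ext (by omega)
    subst hij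
    simp
  · rw [SimpleGraph.cycleGraph_adj, sub_eq_iff_eq_add', sub_eq_iff_eq_add', or_comm,
      iff_and_self]
    rintro h rfl
    simp at h

theorem lift_transposition_eq_one :
    ∀ r ∈ artinRelators (SimpleGraph.cycleGraph n), FreeGroup.lift (transposition n) r = 1 := by
  rintro r (⟨i, j, h, rfl⟩ | ⟨i, j, hij, h, rfl⟩)
  · simp only [map_mul, map_inv, FreeGroup.lift_apply_of, mul_inv_eq_one]
    rcases ((cycleGraph_adj_iff n).1 h).2 with rfl | rfl
    · exact transposition_braid n
    · exact (transposition_braid n).symm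
  · simp only [map_mul, map_inv, FreeGroup.lift_apply_of, mul_inv_eq_one]
    apply transposition_comm
    · exact fun e => h ((cycleGraph_adj_iff n).2 ⟨hij, Or.inl e⟩)
    · exact fun e => h ((cycleGraph_adj_iff n).2 ⟨hij, Or.inr e⟩)

/-- The homomorphism `σ : A(Δₙ) → Sym(n)`, `aᵢ ↦ (i, i + 1)` for `i < n` and `aₙ ↦ (1, n)`. -/
def sigma : PolygonGroup n →* Equiv.Perm (Fin n) :=
  PresentedGroup.toGroup (lift_transposition_eq_one n)

/-- `H ≤ A(Δₙ)`: the preimage under `σ` of the stabiliser of the unordered pair `{1, 2}`. -/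
def H : Subgroup (PolygonGroup n) :=
  (MulAction.stabilizer (Equiv.Perm (Fin n)) ({Fin.ofNat n 1, Fin.ofNat n 2} : Set (Fin n))).comap
    (sigma n)

/-- The quotient `G₀` of `A(Δₙ)` by the normal closure of the cycle commutator of `a₁, …, aₙ`. -/
abbrev G0 : Type :=
  PolygonGroup n ⧸ Subgroup.normalClosure {cycleCommutator n (a n)}

/-- The quotient `Gₜ` of `A(Δₙ)` by the normal closure of the `t`-twisted cycle commutator of
`a₁, …, aₙ`. -/
abbrev G (t : ℕ) : Type :=
  PolygonGroup n ⧸ Subgroup.normalClosure {twistedCycleCommutator n t (a n)}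

/-- The image `H₀` of `H` in `G₀`. -/
def H0 : Subgroup (G0 n) := (H n).map (QuotientGroup.mk' _)

/-- The image `Hₜ` of `H` in `Gₜ`. -/
def Ht (t : ℕ) : Subgroup (G n t) := (H n).map (QuotientGroup.mk' _)

end Polygon

end PolygonArtin

namespace PolygonArtin

/-! Since `H` is the stabiliser of one unordered pair in a transitive action, homomorphisms from `H`
to an abelian group `M` correspond, as in Shapiro's lemma, to `M`-valued cocycles of the whole group
on pairs, up to coboundaries.

A cocycle is a labelling of the edges of the graph on which the generators move pairs of points
around the polygon. A coboundary makes it vanish on a spanning tree. The commutation and braid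
relations then leave four free values: `far`, `both`, `link`, `wind` (`IsCocycle.eq_pairWeight`,
`IsCocycle.exists_weights`). Conversely any four values satisfy the relations (`pairWeight_comm`,
`pairWeight_braid`). Hence every homomorphism on `H` is given by weights (`exists_weights_hom`), and
the abelianization of `H` is free on the four universal ones.

Let `r` be a twisted cycle commutator. It acts trivially on vertices, so the value at `{1, 2}` of a
conjugate of `r` is the value of `r` at another pair. These values vanish except at pairs containing
exactly one of 1, 2, where they are plus or minus twice `upDefect` or `downDefect`; `downDefect`
occurs only when `t` is nonzero (`Weights.cocycle_twistedCycleCommutator_one`,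
`Weights.cocycle_twistedCycleCommutator_of_fixed`).

Since `wind` has coefficient -1 in `upDefect`, the latter can replace `wind` as a basis element. For
`t = 0` the only relation is that twice this element vanishes. For `t > 0` the difference of the two
defects is twice `link - far - both`, so the second relation says that four times this element
vanishes; it can replace `link` in the basis. -/

/-- Parameters of an abelian invariant of `H`: the values of a generator `aᵢ` on a pair disjoint
from `{i, i + 1}`, on the pair `{i, i + 1}`, of `aᵢ ^ 2` on a pair meeting `{i, i + 1}` once, and of
a full turn around the polygon. -/
structure Weights (M : Type*) where
  far : M
  both : M
  link : M
  wind : M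

/-! ### Local weights and the Artin relations -/

section PairWeight

variable {α M : Type*} [DecidableEq α] [AddCommGroup M]

/-- The value on the pair `{p, q}` of a generator exchanging `i` and `j`, where `u` is the value of
a move from `i` to `j`. -/
def pairWeight (W : Weights M) (u : M) (i j p q : α) : M :=
  if p = i then (if q = j then W.both else u)
  else if p = j then (if q = i then W.both else W.link - u)
  else if q = i then u
  else if q = j then W.link - u
  else W.far

theorem pairWeight_symm (W : Weights M) (u : M) {i j p q : α} (h : p ≠ q) :
    pairWeight W u i j p q = pairWeight W u i j q p := by
  unfold pairWeight
  split_ifs <;> simp_all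

theorem pairWeight_comm (W : Weights M) (u v : M) {i j k l : α} (hik : i ≠ k) (hil : i ≠ l)
    (hjk : j ≠ k) (hjl : j ≠ l) (p q : α) :
    pairWeight W u i j (Equiv.swap k l p) (Equiv.swap k l q) + pairWeight W v k l p q =
      pairWeight W v k l (Equiv.swap i j p) (Equiv.swap i j q) + pairWeight W u i j p q := by
  unfold pairWeight
  simp only [Equiv.swap_apply_def]
  by_cases p = i <;> by_cases p = j <;> by_cases p = k <;> by_cases p = l <;>
  by_cases q = i <;> by_cases q = j <;> by_cases q = k <;> by_cases q = l <;>
  first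
  | (exfalso; grind)
  | (subst_vars; simp_all [eq_comm]; done)
  | (subst_vars; simp_all [eq_comm]; abel)

/-- Both sides make the same moves up to order: a point travelling from `i` to `k` contributes `u +
v`, while the middle point `j` goes out and back and contributes `link`, so that its `u` or `v`
cancels. The identity also holds for `p = q`, so the action built from it needs no restriction to
distinct vertices. -/
theorem pairWeight_braid (W : Weights M) (u v : M) {i j k : α} (hij : i ≠ j) (hik : i ≠ k)
    (hjk : j ≠ k) (p q : α) :
    pairWeight W u i j (Equiv.swap j k (Equiv.swap i j p)) (Equiv.swap j k (Equiv.swap i j q)) +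
        pairWeight W v j k (Equiv.swap i j p) (Equiv.swap i j q) + pairWeight W u i j p q =
      pairWeight W v j k (Equiv.swap i j (Equiv.swap j k p)) (Equiv.swap i j (Equiv.swap j k q)) +
        pairWeight W u i j (Equiv.swap j k p) (Equiv.swap j k q) + pairWeight W v j k p q := by
  unfold pairWeight
  simp only [Equiv.swap_apply_def]
  by_cases p = i <;> by_cases p = j <;> by_cases p = k <;>
  by_cases q = i <;> by_cases q = j <;> by_cases q = k <;>
  first
  | (exfalso; grind)
  | (subst_vars; simp_all [eq_comm]; done)
  | (subst_vars; simp_all [eq_comm]; abel)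

end PairWeight
-- The defining relations in cyclic notation
section Relations

variable (n : ℕ) [NeZero n]

theorem of_braid (hn : 4 < n) (i : Fin n) :
    (PresentedGroup.of i * PresentedGroup.of (i + 1) * PresentedGroup.of i : PolygonGroup n) =
      PresentedGroup.of (i + 1) * PresentedGroup.of i * PresentedGroup.of (i + 1) := by
  have hadj : (SimpleGraph.cycleGraph n).Adj i (i + 1) := by
    rw [cycleGraph_adj_iff]
    refine ⟨fun h => ?_, Or.inl rfl⟩
    have : (1 : Fin n) = 0 := by simpa using h.symm
    have := congrArg Fin.val this
    rw [Fin.val_one', Nat.mod_eq_of_lt (by omega)] at this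
    simp at this
  rw [← mul_inv_eq_one]
  exact PresentedGroup.one_of_mem (rels := artinRelators (SimpleGraph.cycleGraph n))
    (Or.inl ⟨i, i + 1, hadj, rfl⟩)

theorem of_comm {i j : Fin n} (hij : i ≠ j) (h1 : j ≠ i + 1) (h2 : i ≠ j + 1) :
    (PresentedGroup.of i * PresentedGroup.of j : PolygonGroup n) =
      PresentedGroup.of j * PresentedGroup.of i := by
  rw [← mul_inv_eq_one]
  refine PresentedGroup.one_of_mem (rels := artinRelators (SimpleGraph.cycleGraph n))
    (Or.inr ⟨i, j, hij, fun h => ?_, rfl⟩)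
  rcases ((cycleGraph_adj_iff n).1 h).2 with h | h
  · exact h1 h
  · exact h2 h

@[simp]
theorem sigma_of (i : Fin n) : sigma n (PresentedGroup.of i) = Equiv.swap i (i + 1) :=
  PresentedGroup.toGroup.of _

variable {n}

theorem fin_one_ne_zero (hn : 4 < n) : (1 : Fin n) ≠ 0 := by
  intro h
  have := congrArg Fin.val h
  rw [Fin.val_one', Nat.mod_eq_of_lt (by omega)] at this
  simp at this

theorem fin_two_ne_zero (hn : 4 < n) : (1 + 1 : Fin n) ≠ 0 := by
  intro h
  have := congrArg Fin.val h
  rw [Fin.val_add, Fin.val_one', Nat.mod_eq_of_lt (by omega : 1 < n),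
    Nat.mod_eq_of_lt (by omega)] at this
  simp at this

end Relations

/-! ### Cocycles on pairs and the homomorphisms they induce on `H` -/

section Cocycle

variable {n : ℕ} [NeZero n] {M N : Type*} [AddCommGroup M] [AddCommGroup N]

/-- A cocycle of the action of `A(Δₙ)` on the unordered pairs of distinct vertices. -/
structure IsCocycle (c : PolygonGroup n → Fin n → Fin n → M) : Prop where
  mul : ∀ g h p q, p ≠ q → c (g * h) p q = c g (sigma n h p) (sigma n h q) + c h p q
  symm : ∀ g p q, p ≠ q → c g p q = c g q p

namespace IsCocycle

variable {c d : PolygonGroup n → Fin n → Fin n → M}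

theorem one (hc : IsCocycle c) {p q : Fin n} (h : p ≠ q) : c 1 p q = 0 := by
  simpa using hc.mul 1 1 p q h

theorem inv (hc : IsCocycle c) (g : PolygonGroup n) {p q : Fin n} (h : p ≠ q) :
    c g⁻¹ p q = -c g (sigma n g⁻¹ p) (sigma n g⁻¹ q) := by
  have := hc.mul g g⁻¹ p q h
  rw [mul_inv_cancel, hc.one h] at this
  exact (neg_eq_of_add_eq_zero_right this.symm).symm

theorem ext (hc : IsCocycle c) (hd : IsCocycle d)
    (h : ∀ i p q, p ≠ q → c (PresentedGroup.of i) p q = d (PresentedGroup.of i) p q)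
    (g : PolygonGroup n) {p q : Fin n} (hpq : p ≠ q) : c g p q = d g p q := by
  have hg : g ∈ Subgroup.closure (Set.range
      (PresentedGroup.of (rels := artinRelators (SimpleGraph.cycleGraph n)))) := by
    rw [PresentedGroup.closure_range_of]; trivial
  induction hg using Subgroup.closure_induction generalizing p q with
  | mem x hx => obtain ⟨i, rfl⟩ := hx; exact h i p q hpq
  | one => rw [hc.one hpq, hd.one hpq]
  | mul x y _ _ hx hy =>
    rw [hc.mul _ _ _ _ hpq, hd.mul _ _ _ _ hpq, hy hpq,
      hx ((sigma n y).injective.ne hpq)]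
  | inv x _ hx =>
    rw [hc.inv _ hpq, hd.inv _ hpq, hx ((sigma n x⁻¹).injective.ne hpq)]

theorem map (hc : IsCocycle c) (L : M →+ N) : IsCocycle fun g p q => L (c g p q) where
  mul g h p q hpq := by simp [hc.mul g h p q hpq]
  symm g p q hpq := by simp [hc.symm g p q hpq]

theorem add_coboundary (hc : IsCocycle c) {U : Fin n → Fin n → M} (hU : ∀ p q, U p q = U q p) :
    IsCocycle fun g p q => c g p q + U (sigma n g p) (sigma n g q) - U p q where
  mul g h p q hpq := by
    simp only [hc.mul g h p q hpq, map_mul, Equiv.Perm.mul_apply]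
    abel
  symm g p q hpq := by
    simp only [hc.symm g p q hpq]
    rw [hU p q, hU (sigma n g p)]

/-- The contributions of `g` and its inverse cancel because `r` returns every point to its place.
Conjugating `r` thus only changes the pair at which it is evaluated. -/
theorem conj (hc : IsCocycle c) {r : PolygonGroup n} (hr : sigma n r = 1) (g : PolygonGroup n)
    {p q : Fin n} (hpq : p ≠ q) :
    c (g⁻¹ * r * g) p q = c r (sigma n g p) (sigma n g q) := by
  have h1 := (sigma n g).injective.ne hpq
  rw [hc.mul _ _ _ _ hpq, hc.mul _ _ _ _ h1, hr, hc.inv g (by simpa using h1)]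
  simp

end IsCocycle

theorem mem_H_iff {g : PolygonGroup n} :
    g ∈ H n ↔ ({sigma n g (Fin.ofNat n 1), sigma n g (Fin.ofNat n 2)} : Set (Fin n)) =
      {Fin.ofNat n 1, Fin.ofNat n 2} := by
  rw [H, Subgroup.mem_comap, MulAction.mem_stabilizer_iff, ← Set.image_smul, Set.image_pair]
  rfl

theorem ofNat_one_ne_two (hn : 4 < n) : Fin.ofNat n 1 ≠ Fin.ofNat n 2 := by
  intro h
  have := congrArg Fin.val h
  simp [Fin.ofNat, Nat.mod_eq_of_lt (by omega : 1 < n), Nat.mod_eq_of_lt (by omega : 2 < n)] at this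

/-- A function which is symmetric in two variables depends only on the unordered pair. -/
theorem eq_of_pair_eq {α β : Type*} {f : α → α → β} (hf : ∀ p q, p ≠ q → f p q = f q p)
    {p q r s : α} (hpq : p ≠ q) (h : ({p, q} : Set α) = {r, s}) : f p q = f r s := by
  rcases Set.pair_eq_pair_iff.1 h with ⟨rfl, rfl⟩ | ⟨rfl, rfl⟩
  · rfl
  · exact hf _ _ hpq

/-- The homomorphism `H → M` given by the restriction of a cocycle to `{1, 2}`. -/
def IsCocycle.hom {c : PolygonGroup n → Fin n → Fin n → M} (hc : IsCocycle c) (hn : 4 < n) :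
    H n →* Multiplicative M :=
  MonoidHom.mk' (fun h => Multiplicative.ofAdd (c h (Fin.ofNat n 1) (Fin.ofNat n 2))) fun g h => by
    rw [← ofAdd_add, Subgroup.coe_mul, hc.mul _ _ _ _ (ofNat_one_ne_two hn)]
    congr 2
    exact eq_of_pair_eq (hc.symm g) ((sigma n h).injective.ne (ofNat_one_ne_two hn))
      (mem_H_iff.1 h.2)

theorem IsCocycle.hom_apply {c : PolygonGroup n → Fin n → Fin n → M} (hc : IsCocycle c)
    (hn : 4 < n) (h : H n) :
    hc.hom hn h = Multiplicative.ofAdd (c h (Fin.ofNat n 1) (Fin.ofNat n 2)) := rfl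

theorem IsCocycle.conj_eq_zero {c : PolygonGroup n → Fin n → Fin n → M} (hc : IsCocycle c)
    {r : PolygonGroup n} (hr : sigma n r = 1) (h0 : ∀ p q, p ≠ q → c r p q = 0)
    {g : PolygonGroup n} (hg : g ∈ Subgroup.normalClosure {r}) :
    sigma n g = 1 ∧ ∀ p q, p ≠ q → c g p q = 0 := by
  induction hg using Subgroup.closure_induction with
  | mem x hx =>
    obtain ⟨y, hy, hxy⟩ := Group.mem_conjugatesOfSet_iff.1 hx
    obtain rfl := Set.mem_singleton_iff.1 hy
    obtain ⟨b, rfl⟩ := isConj_iff.1 hxy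
    refine ⟨by simp [hr], fun p q hpq => ?_⟩
    have := hc.conj hr b⁻¹ hpq
    rw [inv_inv] at this
    rw [this]
    exact h0 _ _ ((sigma n b⁻¹).injective.ne hpq)
  | one => exact ⟨map_one _, fun p q hpq => hc.one hpq⟩
  | mul x y _ _ hx hy =>
    refine ⟨by simp [hx.1, hy.1], fun p q hpq => ?_⟩
    rw [hc.mul _ _ _ _ hpq, hy.1, hy.2 p q hpq]
    simpa using hx.2 p q hpq
  | inv x _ hx =>
    refine ⟨by simp [hx.1], fun p q hpq => ?_⟩
    rw [hc.inv _ hpq, map_inv, hx.1]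
    simpa using hx.2 p q hpq

end Cocycle

/-! ### The cocycle attached to four weights -/

section WeightCocycle

variable {n : ℕ} [NeZero n] {M N : Type*} [AddCommGroup M] [AddCommGroup N]

namespace Weights

/-- The value of a move from `i` to `i + 1`; full turns are counted between the vertices `n` and
`1`. -/
def shift (W : Weights M) (i : Fin n) : M := if i = 0 then W.wind else 0

/-- The action of the generator `aᵢ` on pairs of vertices with a label in `M`. -/
def step (W : Weights M) (i : Fin n) : Equiv.Perm (Fin n × Fin n × M) where
  toFun x := (Equiv.swap i (i + 1) x.1, Equiv.swap i (i + 1) x.2.1,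
    x.2.2 + pairWeight W (W.shift i) i (i + 1) x.1 x.2.1)
  invFun x := (Equiv.swap i (i + 1) x.1, Equiv.swap i (i + 1) x.2.1,
    x.2.2 - pairWeight W (W.shift i) i (i + 1) (Equiv.swap i (i + 1) x.1)
      (Equiv.swap i (i + 1) x.2.1))
  left_inv x := by simp
  right_inv x := by simp

theorem step_apply (W : Weights M) (i p q : Fin n) (m : M) :
    W.step i (p, q, m) = (Equiv.swap i (i + 1) p, Equiv.swap i (i + 1) q,
      m + pairWeight W (W.shift i) i (i + 1) p q) := rfl

theorem step_braid (hn : 4 < n) (W : Weights M) (i : Fin n) :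
    W.step i * W.step (i + 1) * W.step i = W.step (i + 1) * W.step i * W.step (i + 1) := by
  have h1 : i ≠ i + 1 := fun h => fin_one_ne_zero hn (by simpa using h.symm)
  have h2 : i + 1 ≠ i + 1 + 1 := fun h => fin_one_ne_zero hn (by simpa using h.symm)
  have h3 : i ≠ i + 1 + 1 := fun h => fin_two_ne_zero hn (by simpa [add_assoc] using h.symm)
  have hσ := transposition_braid n (i := i)
  unfold transposition at hσ
  refine Equiv.ext fun ⟨p, q, m⟩ => ?_
  simp only [Equiv.Perm.mul_apply, step_apply]
  refine Prod.ext ?_ (Prod.ext ?_ ?_)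
  · exact congrArg (fun f => f p) hσ
  · exact congrArg (fun f => f q) hσ
  · have := pairWeight_braid W (W.shift i) (W.shift (i + 1)) h1 h3 h2 p q
    dsimp only
    have e : ∀ x y z : M, m + x + y + z = m + (z + y + x) := by intros; abel
    rw [e, e, this]

theorem step_comm (W : Weights M) {i j : Fin n} (hij : i ≠ j) (h1 : j ≠ i + 1)
    (h2 : i ≠ j + 1) : W.step i * W.step j = W.step j * W.step i := by
  have hσ := transposition_comm n h1 h2
  unfold transposition at hσ
  refine Equiv.ext fun ⟨p, q, m⟩ => ?_
  simp only [Equiv.Perm.mul_apply, step_apply]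
  refine Prod.ext ?_ (Prod.ext ?_ ?_)
  · exact congrArg (fun f => f p) hσ
  · exact congrArg (fun f => f q) hσ
  · have := pairWeight_comm W (W.shift i) (W.shift j) hij h2 h1.symm
      (fun h => hij (add_right_cancel h)) p q
    dsimp only
    rw [add_assoc, add_assoc, add_comm (pairWeight W (W.shift j) _ _ p q), this, add_comm]
    abel

/-- The action of `A(Δₙ)` on pairs of vertices with a label in `M`. -/
def action (W : Weights M) (hn : 4 < n) : PolygonGroup n →* Equiv.Perm (Fin n × Fin n × M) :=
  PresentedGroup.toGroup (f := W.step) <| by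
    rintro r (⟨i, j, h, rfl⟩ | ⟨i, j, hij, h, rfl⟩)
    · simp only [map_mul, map_inv, FreeGroup.lift_apply_of, mul_inv_eq_one]
      rcases ((cycleGraph_adj_iff n).1 h).2 with rfl | rfl
      · exact W.step_braid hn i
      · exact (W.step_braid hn j).symm
    · simp only [map_mul, map_inv, FreeGroup.lift_apply_of, mul_inv_eq_one]
      apply W.step_comm hij
      · exact fun e => h ((cycleGraph_adj_iff n).2 ⟨hij, Or.inl e⟩)
      · exact fun e => h ((cycleGraph_adj_iff n).2 ⟨hij, Or.inr e⟩)

/-- The cocycle with given weights. -/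
def cocycle (W : Weights M) (hn : 4 < n) (g : PolygonGroup n) (p q : Fin n) : M :=
  (W.action hn g (p, q, 0)).2.2

theorem action_apply (W : Weights M) (hn : 4 < n) (g : PolygonGroup n) (p q : Fin n) (m : M) :
    W.action hn g (p, q, m) = (sigma n g p, sigma n g q, m + W.cocycle hn g p q) := by
  -- Only the existence of some label-independent increment has to pass through the induction on
  -- words; evaluation at label 0 identifies it with `cocycle`.
  suffices h : ∃ c : Fin n → Fin n → M, ∀ p q m,
      W.action hn g (p, q, m) = (sigma n g p, sigma n g q, m + c p q) by
    obtain ⟨c, h⟩ := h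
    rw [cocycle, h, h, zero_add]
  have hg : g ∈ Subgroup.closure (Set.range
      (PresentedGroup.of (rels := artinRelators (SimpleGraph.cycleGraph n)))) := by
    rw [PresentedGroup.closure_range_of]; trivial
  induction hg using Subgroup.closure_induction with
  | mem x hx =>
    obtain ⟨i, rfl⟩ := hx
    refine ⟨pairWeight W (W.shift i) i (i + 1), fun p q m => ?_⟩
    rw [sigma_of, ← step_apply, action, PresentedGroup.toGroup.of]
  | one => exact ⟨0, fun p q m => by simp⟩
  | mul x y _ _ hx hy =>
    obtain ⟨c, hc⟩ := hx
    obtain ⟨d, hd⟩ := hy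
    refine ⟨fun p q => d p q + c (sigma n y p) (sigma n y q), fun p q m => ?_⟩
    rw [map_mul, Equiv.Perm.mul_apply, hd, hc]
    simp [add_assoc]
  | inv x _ hx =>
    obtain ⟨c, hc⟩ := hx
    refine ⟨fun p q => -c (sigma n x⁻¹ p) (sigma n x⁻¹ q), fun p q m => ?_⟩
    rw [map_inv, Equiv.Perm.inv_eq_iff_eq, hc]
    simp

theorem cocycle_of (W : Weights M) (hn : 4 < n) (i p q : Fin n) :
    W.cocycle hn (PresentedGroup.of i) p q = pairWeight W (W.shift i) i (i + 1) p q := by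
  rw [cocycle, action, PresentedGroup.toGroup.of, step_apply]
  simp

theorem cocycle_mul (W : Weights M) (hn : 4 < n) (g h : PolygonGroup n) (p q : Fin n) :
    W.cocycle hn (g * h) p q = W.cocycle hn g (sigma n h p) (sigma n h q) + W.cocycle hn h p q := by
  have := W.action_apply hn (g * h) p q 0
  rw [map_mul, Equiv.Perm.mul_apply, action_apply, action_apply] at this
  simp only [Prod.mk.injEq, zero_add] at this
  rw [← this.2.2, add_comm]

theorem isCocycle (W : Weights M) (hn : 4 < n) : IsCocycle (W.cocycle (n := n) hn) where
  mul g h p q _ := W.cocycle_mul hn g h p q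
  symm g p q hpq := by
    have hg : g ∈ Subgroup.closure (Set.range
        (PresentedGroup.of (rels := artinRelators (SimpleGraph.cycleGraph n)))) := by
      rw [PresentedGroup.closure_range_of]; trivial
    have one : ∀ p q, W.cocycle hn (1 : PolygonGroup n) p q = 0 := fun p q => by simp [cocycle]
    induction hg using Subgroup.closure_induction generalizing p q with
    | mem x hx => obtain ⟨i, rfl⟩ := hx; rw [cocycle_of, cocycle_of, pairWeight_symm W _ hpq]
    | one => rw [one, one]
    | mul x y _ _ hx hy =>
      rw [cocycle_mul, cocycle_mul, hy p q hpq, hx _ _ ((sigma n y).injective.ne hpq)]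
    | inv x _ hx =>
      have inv : ∀ p q, W.cocycle hn x⁻¹ p q =
          -W.cocycle hn x (sigma n x⁻¹ p) (sigma n x⁻¹ q) := fun p q => by
        have := W.cocycle_mul hn x x⁻¹ p q
        rw [mul_inv_cancel, one] at this
        exact (neg_eq_of_add_eq_zero_right this.symm).symm
      rw [inv, inv, hx _ _ ((sigma n x⁻¹).injective.ne hpq)]

/-- The image of weights under a homomorphism. -/
def map (W : Weights M) (L : M →+ N) : Weights N := ⟨L W.far, L W.both, L W.link, L W.wind⟩

theorem map_cocycle (W : Weights M) (L : M →+ N) (hn : 4 < n) (g : PolygonGroup n) {p q : Fin n}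
    (hpq : p ≠ q) : L (W.cocycle hn g p q) = (W.map L).cocycle hn g p q := by
  refine ((W.isCocycle hn).map L).ext ((W.map L).isCocycle hn) (fun i p q _ => ?_) g hpq
  simp only [cocycle_of, pairWeight, map, shift]
  split_ifs <;> simp

end Weights
end WeightCocycle
-- Vertices as natural numbers modulo `n`
section Vertices

variable {n : ℕ} [NeZero n]

theorem ofNat_succ (k : ℕ) : Fin.ofNat n (k + 1) = Fin.ofNat n k + 1 := by
  apply Fin.ext
  simp [Fin.ofNat, Fin.val_add]

theorem ofNat_add_self (k : ℕ) : Fin.ofNat n (k + n) = Fin.ofNat n k := by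
  apply Fin.ext
  simp [Fin.ofNat]

theorem ofNat_ne {p q : ℕ} (h : p < q) (h' : q < p + n) : Fin.ofNat n p ≠ Fin.ofNat n q := by
  intro e
  have e : p % n = q % n := congrArg Fin.val e
  have : n ∣ q - p := (Nat.modEq_iff_dvd' h.le).1 e
  exact absurd (Nat.le_of_dvd (by omega) this) (by omega)

theorem ofNat_ne' {p q : ℕ} (h : p < q) (h' : q < p + n) : Fin.ofNat n q ≠ Fin.ofNat n p :=
  (ofNat_ne h h').symm

/-- Cutting the polygon open at an arbitrary `s` gives each vertex a representative in one window of
length `n`, where cyclic conditions become linear inequalities. -/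
theorem exists_ofNat_eq (s : ℕ) (p : Fin n) : ∃ k, s ≤ k ∧ k < s + n ∧ Fin.ofNat n k = p := by
  have hn : 0 < n := Nat.pos_of_ne_zero (NeZero.ne n)
  induction s with
  | zero => exact ⟨p, by omega, by omega, Fin.ext (Nat.mod_eq_of_lt p.2)⟩
  | succ s ih =>
    obtain ⟨k, h1, h2, h3⟩ := ih
    rcases h1.eq_or_lt with rfl | h
    · exact ⟨s + n, by omega, by omega, by rw [ofNat_add_self, h3]⟩
    · exact ⟨k, by omega, by omega, h3⟩

theorem sigma_a (i : ℕ) :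
    sigma n (a n i) = Equiv.swap (Fin.ofNat n i) (Fin.ofNat n (i + 1)) := by
  rw [a, sigma_of, ofNat_succ]

theorem sigma_a_left (i : ℕ) : sigma n (a n i) (Fin.ofNat n i) = Fin.ofNat n (i + 1) := by
  rw [sigma_a, Equiv.swap_apply_left]

theorem sigma_a_right (i : ℕ) : sigma n (a n i) (Fin.ofNat n (i + 1)) = Fin.ofNat n i := by
  rw [sigma_a, Equiv.swap_apply_right]

theorem sigma_a_of_gt {i p : ℕ} (h : i + 1 < p) (h' : p < i + n) :
    sigma n (a n i) (Fin.ofNat n p) = Fin.ofNat n p := by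
  rw [sigma_a, Equiv.swap_apply_of_ne_of_ne (ofNat_ne' (by omega) (by omega))
    (ofNat_ne' (by omega) (by omega))]

theorem sigma_a_of_lt {i p : ℕ} (h : p < i) (h' : i + 1 < p + n) :
    sigma n (a n i) (Fin.ofNat n p) = Fin.ofNat n p := by
  rw [sigma_a, Equiv.swap_apply_of_ne_of_ne (ofNat_ne (by omega) (by omega))
    (ofNat_ne (by omega) (by omega))]

theorem a_braid (hn : 4 < n) (i : ℕ) :
    a n i * a n (i + 1) * a n i = a n (i + 1) * a n i * a n (i + 1) := by
  rw [a, a, ofNat_succ]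
  exact of_braid n hn _

theorem a_comm {i j : ℕ} (h : i + 1 < j) (h' : j + 1 < i + n) :
    a n i * a n j = a n j * a n i := by
  refine of_comm n (ofNat_ne (by omega) (by omega)) ?_ ?_
  · rw [← ofNat_succ]; exact ofNat_ne' (by omega) (by omega)
  · rw [← ofNat_succ]; exact ofNat_ne (by omega) (by omega)

theorem a_add_self (i : ℕ) : a n (i + n) = a n i := by rw [a, a, ofNat_add_self]

end Vertices

/-! ### What the relations force on the generator values of a cocycle -/

section Normalized

variable {n : ℕ} [NeZero n] {M : Type*} [AddCommGroup M]

/-- The value of a cocycle at the generator `aᵢ` and the vertices `p`, `q`. -/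
def genValue (c : PolygonGroup n → Fin n → Fin n → M) (i p q : ℕ) : M :=
  c (a n i) (Fin.ofNat n p) (Fin.ofNat n q)

namespace IsCocycle

variable {c : PolygonGroup n → Fin n → Fin n → M}

theorem genValue_symm (hc : IsCocycle c) (i : ℕ) {p q : ℕ} (h : p < q) (h' : q < p + n) :
    genValue c i p q = genValue c i q p := hc.symm _ _ _ (ofNat_ne h h')

/-- Evaluation of the braid relation. -/
theorem genValue_braid (hc : IsCocycle c) (hn : 4 < n) (i : ℕ) {p q : Fin n} (hpq : p ≠ q) :
    c (a n i) (sigma n (a n (i + 1)) (sigma n (a n i) p))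
          (sigma n (a n (i + 1)) (sigma n (a n i) q)) +
        (c (a n (i + 1)) (sigma n (a n i) p) (sigma n (a n i) q) + c (a n i) p q) =
      c (a n (i + 1)) (sigma n (a n i) (sigma n (a n (i + 1)) p))
          (sigma n (a n i) (sigma n (a n (i + 1)) q)) +
        (c (a n i) (sigma n (a n (i + 1)) p) (sigma n (a n (i + 1)) q) + c (a n (i + 1)) p q) := by
  have h := congrArg (fun g => c g p q) (a_braid hn i)
  simpa only [mul_assoc, hc.mul _ _ _ _ hpq, hc.mul _ _ _ _ ((sigma n _).injective.ne hpq),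
    map_mul, Equiv.Perm.mul_apply] using h

/-- Evaluation of the commutation relation. -/
theorem genValue_comm (hc : IsCocycle c) {i j : ℕ} (h : i + 1 < j) (h' : j + 1 < i + n)
    {p q : Fin n} (hpq : p ≠ q) :
    c (a n i) (sigma n (a n j) p) (sigma n (a n j) q) + c (a n j) p q =
      c (a n j) (sigma n (a n i) p) (sigma n (a n i) q) + c (a n i) p q := by
  have h := congrArg (fun g => c g p q) (a_comm h h')
  simpa only [hc.mul _ _ _ _ hpq] using h

/-- The braid relation at `{i, q}`: the two upward moves of the point at `i` occur on both sides and
cancel, leaving one value of each generator away from its support. -/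
theorem genValue_far_succ (hc : IsCocycle c) (hn : 4 < n) {i q : ℕ} (h : i + 2 < q)
    (h' : q < i + n) : genValue c i (i + 2) q = genValue c (i + 1) i q := by
  have := hc.genValue_braid hn i (ofNat_ne (n := n) (p := i) (q := q) (by omega) (by omega))
  rw [sigma_a_left, sigma_a_left, sigma_a_of_gt (i := i) (p := q) (by omega) (by omega),
    sigma_a_of_gt (i := i + 1) (p := q) (by omega) (by omega),
    sigma_a_of_lt (i := i + 1) (p := i) (by omega) (by omega), sigma_a_left,
    sigma_a_of_gt (i := i) (p := q) (by omega) (by omega), ← add_assoc] at this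
  simp only [genValue]
  rw [← add_right_inj (c (a n i) (Fin.ofNat n i) (Fin.ofNat n q)),
    ← add_right_inj (c (a n (i + 1)) (Fin.ofNat n (i + 1)) (Fin.ofNat n q))]
  convert this using 1
  abel

/-- The braid relation at `{i, i + 1}`; the moves of one point past the other cancel. -/
theorem genValue_both_succ (hc : IsCocycle c) (hn : 4 < n) (i : ℕ) :
    genValue c i i (i + 1) = genValue c (i + 1) (i + 1) (i + 2) := by
  have := hc.genValue_braid hn i (ofNat_ne (n := n) (p := i) (q := i + 1) (by omega) (by omega))
  rw [sigma_a_left, sigma_a_left, sigma_a_right,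
    sigma_a_of_lt (i := i + 1) (p := i) (by omega) (by omega), sigma_a_left,
    sigma_a_of_gt (i := i) (p := i + 1 + 1) (by omega) (by omega),
    hc.symm _ _ _ (ofNat_ne' (n := n) (p := i) (q := i + 1) (by omega) (by omega)),
    hc.symm _ _ _ (ofNat_ne' (n := n) (p := i) (q := i + 1 + 1) (by omega) (by omega))] at this
  simp only [genValue]
  rw [← add_right_inj (c (a n i) (Fin.ofNat n i) (Fin.ofNat n (i + 1 + 1)) +
    c (a n (i + 1)) (Fin.ofNat n i) (Fin.ofNat n (i + 1)))]
  convert this using 1 <;> abel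

theorem genValue_link_succ (hc : IsCocycle c) (hn : 4 < n) {i q : ℕ} (h : i + 2 < q)
    (h' : q < i + n) : genValue c i i q + genValue c i (i + 1) q =
      genValue c (i + 1) (i + 1) q + genValue c (i + 1) (i + 2) q := by
  have h0 := hc.genValue_far_succ hn h h'
  have := hc.genValue_braid hn i (ofNat_ne (n := n) (p := i + 1) (q := q) (by omega) (by omega))
  rw [sigma_a_left, sigma_a_right, sigma_a_of_gt (i := i) (p := q) (by omega) (by omega),
    sigma_a_of_gt (i := i + 1) (p := q) (by omega) (by omega),
    sigma_a_of_lt (i := i + 1) (p := i) (by omega) (by omega),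
    sigma_a_of_gt (i := i) (p := i + 1 + 1) (by omega) (by omega),
    sigma_a_of_gt (i := i) (p := q) (by omega) (by omega)] at this
  simp only [genValue] at h0 ⊢
  rw [h0] at this
  rw [← add_right_inj (c (a n (i + 1)) (Fin.ofNat n i) (Fin.ofNat n q))]
  convert this using 1 <;> abel

/-- Commuting generators move the two points independently, giving a square of pairs; its two
boundary paths have equal value. -/
theorem genValue_square (hc : IsCocycle c) {i j : ℕ} (h : i + 1 < j) (h' : j + 1 < i + n) :
    genValue c i i (j + 1) + genValue c j i j = genValue c j (i + 1) j + genValue c i i j := by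
  have := hc.genValue_comm h h' (ofNat_ne (n := n) (p := i) (q := j) (by omega) (by omega))
  rwa [sigma_a_left, sigma_a_left, sigma_a_of_gt (i := i) (p := j) (by omega) (by omega),
    sigma_a_of_lt (i := j) (p := i) (by omega) (by omega)] at this

theorem genValue_square' (hc : IsCocycle c) {i j : ℕ} (h : i + 1 < j) (h' : j + 1 < i + n) :
    genValue c i (i + 1) (j + 1) + genValue c j (i + 1) j =
      genValue c j i j + genValue c i (i + 1) j := by
  have := hc.genValue_comm h h' (ofNat_ne (n := n) (p := i + 1) (q := j) (by omega) (by omega))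
  rwa [sigma_a_left, sigma_a_right, sigma_a_of_gt (i := i) (p := j) (by omega) (by omega),
    sigma_a_of_lt (i := j) (p := i + 1) (by omega) (by omega)] at this

theorem genValue_far_right (hc : IsCocycle c) {i j p : ℕ} (h : i + 1 < j) (h' : j + 1 < i + n)
    (hp : i + 1 < p) (hp' : p < i + n) (hpj : p < j ∨ j + 1 < p) :
    genValue c i p (j + 1) = genValue c i p j := by
  have hne : Fin.ofNat n p ≠ Fin.ofNat n j := by
    rcases hpj with hpj | hpj
    · exact ofNat_ne (by omega) (by omega)
    · exact ofNat_ne' (by omega) (by omega)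
  have hs : sigma n (a n j) (Fin.ofNat n p) = Fin.ofNat n p := by
    rcases hpj with hpj | hpj
    · exact sigma_a_of_lt (by omega) (by omega)
    · exact sigma_a_of_gt (by omega) (by omega)
  have := hc.genValue_comm h h' hne
  rw [sigma_a_left, sigma_a_of_gt (i := i) (p := j) (by omega) (by omega), hs,
    sigma_a_of_gt (i := i) (p := p) (by omega) (by omega), add_comm] at this
  exact add_left_cancel this

/-- For fixed `i`, commutation lets each of the two points slide along the arc outside `{i, i + 1}`;
`genValue_far_succ` then passes from one generator to the next. -/
theorem genValue_far (hc : IsCocycle c) (hn : 4 < n) {i p q : ℕ} (hp : i + 1 < p) (hpq : p < q)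
    (hq : q < i + n) : genValue c i p q = genValue c 0 2 3 := by
  have right : ∀ i p q, i + 1 < p → p < q → q < i + n →
      genValue c i p q = genValue c i p (p + 1) := by
    intro i p q hp hpq hq
    induction q, hpq using Nat.le_induction with
    | base => rfl
    | succ q hpq ih =>
      rw [hc.genValue_far_right (by omega) (by omega) hp (by omega) (Or.inl hpq),
        ih (by omega)]
  have left : ∀ i p, i + 2 ≤ p → p + 1 < i + n →
      genValue c i p (p + 1) = genValue c i (i + 2) (i + 3) := by
    intro i p hp hq
    induction p, hp using Nat.le_induction with
    | base => rfl
    | succ p hp ih =>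
      rw [← ih (by omega), ← right i p (p + 2) (by omega) (by omega) (by omega),
        hc.genValue_symm i (p := p) (q := p + 2) (by omega) (by omega),
        ← hc.genValue_far_right (i := i) (j := p) (p := p + 2) (by omega) (by omega) (by omega)
          (by omega) (by omega), hc.genValue_symm i (by omega) (by omega)]
  have base : ∀ i, genValue c i (i + 2) (i + 3) = genValue c 0 2 3 := by
    intro i
    induction i with
    | zero => rfl
    | succ i ih =>
      rw [← ih, hc.genValue_far_succ (q := i + 3) hn (by omega) (by omega)]
      -- The vertex `i` lies behind the window of the generator `i + 1`, so it is renamed `i + n`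
      -- before sliding.
      have : genValue c (i + 1) i (i + 3) = genValue c (i + 1) (i + n) (i + 3) := by
        rw [genValue, genValue, ofNat_add_self]
      rw [this, ← hc.genValue_symm (i + 1) (p := i + 3) (q := i + n) (by omega) (by omega),
        right (i + 1) (i + 3) (i + n) (by omega) (by omega) (by omega)]
  rw [right i p q hp hpq hq, left i p hp (by omega), base]

theorem genValue_both (hc : IsCocycle c) (hn : 4 < n) (i : ℕ) :
    genValue c i i (i + 1) = genValue c 0 0 1 := by
  induction i with
  | zero => rfl
  | succ i ih => rw [← hc.genValue_both_succ hn, ih]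

/-- The sum is the value of the squared generator on a pair it meets once. Adding the two square
relations makes the contributions of the other generator cancel, so the bystander `q` can slide; the
braid relation changes `i`. -/
theorem genValue_link (hc : IsCocycle c) (hn : 4 < n) {i q : ℕ} (hq : i + 1 < q)
    (hq' : q < i + n) :
    genValue c i i q + genValue c i (i + 1) q = genValue c 0 0 2 + genValue c 0 1 2 := by
  have right : ∀ i q, i + 2 ≤ q → q < i + n → genValue c i i q + genValue c i (i + 1) q =
      genValue c i i (i + 2) + genValue c i (i + 1) (i + 2) := by
    intro i q hq hq'
    induction q, hq using Nat.le_induction with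
    | base => rfl
    | succ q hq ih =>
      rw [← ih (by omega)]
      have h1 := hc.genValue_square (i := i) (j := q) (by omega) (by omega)
      have h2 := hc.genValue_square' (i := i) (j := q) (by omega) (by omega)
      rw [← add_right_inj (genValue c q i q + genValue c q (i + 1) q)]
      have := congrArg₂ (· + ·) h1 h2
      convert this using 1 <;> abel
  rw [right i q hq hq']
  clear hq hq'
  induction i with
  | zero => rfl
  | succ i ih =>
    rw [← ih, ← right i (i + 3) (by omega) (by omega),
      hc.genValue_link_succ (i := i) (q := i + 3) hn (by omega) (by omega)]

/-- The hypotheses kill the edges of a spanning tree. Three sides of the square of `p` and `q`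
vanish by `h1` and induction on `p`, hence so does the fourth. -/
theorem genValue_up_lower (hc : IsCocycle c)
    (h1 : ∀ k q, 1 ≤ k → k + 1 < q → q ≤ n → genValue c k k q = 0)
    (h2 : ∀ k, 2 ≤ k → k < n → genValue c k 1 k = 0) {p q : ℕ} (hp : 1 ≤ p) (hpq : p < q)
    (hq : q < n) : genValue c q p q = 0 := by
  induction p, hp using Nat.le_induction with
  | base => exact h2 q hpq hq
  | succ p hp ih =>
    have := hc.genValue_square (i := p) (j := q) (by omega) (by omega)
    rw [h1 p (q + 1) hp (by omega) (by omega), h1 p q hp hpq (by omega), ih (by omega)] at this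
    simpa using this.symm

theorem genValue_up (hc : IsCocycle c)
    (h1 : ∀ k q, 1 ≤ k → k + 1 < q → q ≤ n → genValue c k k q = 0)
    (h2 : ∀ k, 2 ≤ k → k < n → genValue c k 1 k = 0) {i q : ℕ} (hi : 1 ≤ i) (hin : i < n)
    (hq : i + 1 < q) (hq' : q < i + n) : genValue c i i q = 0 := by
  by_cases h : q ≤ n
  · exact h1 i q hi hq h
  · have : genValue c i i q = genValue c i i (q - n) := by
      conv_lhs => rw [show q = q - n + n by omega]
      rw [genValue, genValue, ofNat_add_self]
    rw [this, ← hc.genValue_symm i (by omega) (by omega)]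
    exact hc.genValue_up_lower h1 h2 (by omega) (by omega) hin

/-- In the square of the generators `n` and `q`, the two sides belonging to `q` vanish by `h1` and
`h2`. Crossing from `n` to 1 therefore costs the same wherever the other point is. -/
theorem genValue_wind (hc : IsCocycle c)
    (h1 : ∀ k q, 1 ≤ k → k + 1 < q → q ≤ n → genValue c k k q = 0)
    (h2 : ∀ k, 2 ≤ k → k < n → genValue c k 1 k = 0) {q : ℕ} (hq : 2 ≤ q) (hqn : q < n) :
    genValue c n n (n + q) = genValue c n n (n + 2) := by
  induction q, hq using Nat.le_induction with
  | base => rfl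
  | succ q hq ih =>
    rw [← ih (by omega)]
    have := hc.genValue_square (i := n) (j := n + q) (by omega) (by omega)
    have e1 : genValue c (n + q) n (n + q) = 0 := by
      rw [add_comm n q, genValue, a_add_self, ofNat_add_self,
        hc.symm _ _ _ (ofNat_ne' (by omega) (by omega))]
      exact h1 q n (by omega) (by omega) le_rfl
    have e2 : genValue c (n + q) (n + 1) (n + q) = 0 := by
      rw [add_comm n q, add_comm n 1, genValue, a_add_self, ofNat_add_self, ofNat_add_self]
      exact h2 q (by omega) (by omega)
    rw [e1, e2] at this
    simpa [add_assoc] using this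

theorem eq_pairWeight (hc : IsCocycle c) (hn : 4 < n)
    (h1 : ∀ k q, 1 ≤ k → k + 1 < q → q ≤ n → genValue c k k q = 0)
    (h2 : ∀ k, 2 ≤ k → k < n → genValue c k 1 k = 0) :
    ∃ W : Weights M, ∀ i p q, p ≠ q →
      c (PresentedGroup.of i) p q = pairWeight W (W.shift i) i (i + 1) p q := by
  let W : Weights M := ⟨genValue c 0 2 3, genValue c 0 0 1, genValue c 0 0 2 + genValue c 0 1 2,
    genValue c n n (n + 2)⟩
  refine ⟨W, fun i p q hpq => ?_⟩
  obtain ⟨i, hi1, hi2, rfl⟩ := exists_ofNat_eq 1 i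
  obtain ⟨p, hp1, hp2, rfl⟩ := exists_ofNat_eq i p
  obtain ⟨q, hq1, hq2, rfl⟩ := exists_ofNat_eq i q
  change genValue c i p q = _
  rw [← ofNat_succ]
  have hne : ∀ x, i ≤ x → x < i + n → ∀ y, i ≤ y → y < i + n →
      (Fin.ofNat n x = Fin.ofNat n y ↔ x = y) := by
    intro x hx hx' y hy hy'
    refine ⟨fun h => ?_, fun h => h ▸ rfl⟩
    by_contra hxy
    rcases Nat.lt_or_gt_of_ne hxy with hxy | hxy
    · exact ofNat_ne hxy (by omega) h
    · exact ofNat_ne' hxy (by omega) h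
  have hpq' : p ≠ q := fun h => hpq (h ▸ rfl)
  -- An upward move is free except across the edge from `n` to 1, which carries the winding weight.
  have up : ∀ x, i + 1 < x → x < i + n → genValue c i i x = W.shift (Fin.ofNat n i) := by
    intro x hx hx'
    unfold Weights.shift
    by_cases hin : i = n
    · obtain ⟨y, rfl⟩ := Nat.exists_eq_add_of_le (show n ≤ x by omega)
      rw [if_pos (by rw [hin]; exact Fin.ext (by simp [Fin.ofNat])), hin]
      exact hc.genValue_wind h1 h2 (by omega) (by omega)
    · rw [if_neg, hc.genValue_up h1 h2 hi1 (by omega) hx hx']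
      intro h
      have : i % n = 0 := by simpa [Fin.ofNat] using congrArg Fin.val h
      rw [Nat.mod_eq_of_lt (by omega)] at this
      omega
  have down : ∀ x, i + 1 < x → x < i + n →
      genValue c i (i + 1) x = W.link - W.shift (Fin.ofNat n i) := by
    intro x hx hx'
    rw [← up x hx hx', eq_sub_iff_add_eq, add_comm]
    exact hc.genValue_link hn hx hx'
  unfold pairWeight
  simp only [hne p hp1 hp2 i le_rfl (by omega), hne p hp1 hp2 (i + 1) (by omega) (by omega),
    hne q hq1 hq2 i le_rfl (by omega), hne q hq1 hq2 (i + 1) (by omega) (by omega)]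
  split_ifs with h3 h4 h5 h6 h7 h8
  · rw [h3, h4]; exact hc.genValue_both hn i
  · rw [h3]; exact up q (by omega) hq2
  · rw [h5, h6, ← hc.genValue_symm i (by omega) (by omega)]; exact hc.genValue_both hn i
  · rw [h5]; exact down q (by omega) hq2
  · rw [h7, ← hc.genValue_symm i (by omega) (by omega)]; exact up p (by omega) hp2
  · rw [h8, ← hc.genValue_symm i (by omega) (by omega)]; exact down p (by omega) hp2
  · rcases Nat.lt_or_gt_of_ne hpq' with h | h
    · exact hc.genValue_far hn (by omega) h hq2
    · rw [← hc.genValue_symm i (by omega) (by omega)]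
      exact hc.genValue_far hn (by omega) h hp2

end IsCocycle
end Normalized
-- Normalization along a spanning tree
section Gauge

variable {n : ℕ} [NeZero n] {M : Type*} [AddCommGroup M]

/-- The representative of a vertex in `{1, …, n}`. -/
def rep (p : Fin n) : ℕ := if p = 0 then n else p

theorem rep_ofNat {k : ℕ} (h1 : 1 ≤ k) (h2 : k ≤ n) : rep (Fin.ofNat n k) = k := by
  unfold rep
  rcases h2.lt_or_eq with h | rfl
  · rw [if_neg]
    · exact Nat.mod_eq_of_lt h
    · intro e
      have : k % n = 0 := by simpa [Fin.ofNat] using congrArg Fin.val e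
      rw [Nat.mod_eq_of_lt h] at this
      omega
  · rw [if_pos (Fin.ext (by simp [Fin.ofNat]))]

/-- The value of a cocycle along a path from `{1, 2}` to `{p, q}`, for `1 ≤ p < q ≤ n`. -/
def pathValue (c : PolygonGroup n → Fin n → Fin n → M) (p q : ℕ) : M :=
  ∑ k ∈ Finset.Ico 1 p, genValue c k k q + ∑ k ∈ Finset.Ico 2 q, genValue c k 1 k

theorem IsCocycle.exists_weights {c : PolygonGroup n → Fin n → Fin n → M} (hc : IsCocycle c)
    (hn : 4 < n) : ∃ (W : Weights M) (U : Fin n → Fin n → M), (∀ p q, U p q = U q p) ∧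
      ∀ g p q, p ≠ q → c g p q + U (sigma n g p) (sigma n g q) - U p q = W.cocycle hn g p q := by
  -- The potential is minus the value of the tree path from `{1, 2}`, which first moves the larger
  -- point up and then the smaller. Taking minimum and maximum of representatives makes it
  -- symmetric.
  let U : Fin n → Fin n → M := fun p q =>
    -pathValue c (min (rep p) (rep q)) (max (rep p) (rep q))
  have hU : ∀ p q, U p q = U q p := fun p q => by
    simp only [U]; rw [min_comm, max_comm]
  have hU' : ∀ p q : ℕ, 1 ≤ p → p < q → q ≤ n →
      U (Fin.ofNat n p) (Fin.ofNat n q) = -pathValue c p q := fun p q h1 h2 h3 => by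
    simp only [U]
    rw [rep_ofNat h1 (by omega), rep_ofNat (by omega) h3, min_eq_left h2.le, max_eq_right h2.le]
  have hc' := hc.add_coboundary hU
  obtain ⟨W, hW⟩ := hc'.eq_pairWeight hn
    (fun k q h1 h2 h3 => by
      simp only [genValue]
      rw [sigma_a_left, sigma_a_of_gt h2 (by omega), hU' _ _ (by omega) h2 h3,
        hU' _ _ h1 (by omega) h3, pathValue, pathValue, Finset.sum_Ico_succ_top h1, genValue]
      abel)
    (fun k h1 h2 => by
      simp only [genValue]
      rw [sigma_a_left, sigma_a_of_lt (by omega) (by omega), hU' _ _ le_rfl (by omega) (by omega),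
        hU' _ _ le_rfl (by omega) (by omega), pathValue, pathValue, Finset.sum_Ico_succ_top h1,
        Finset.Ico_self, Finset.sum_empty, Finset.sum_empty, genValue]
      abel)
  refine ⟨W, U, hU, fun g p q hpq => ?_⟩
  exact hc'.ext (W.isCocycle hn) (fun i p q h => by rw [hW i p q h, W.cocycle_of]) g hpq

end Gauge

/-! ### From homomorphisms on `H` to cocycles: Shapiro's lemma -/

section Transversal

variable {n : ℕ} [NeZero n]

theorem sigma_surjective : Function.Surjective (sigma n) := by
  obtain _ | m := n
  · exact absurd rfl (NeZero.ne 0)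
  intro x
  have hx : x ∈ Submonoid.closure
      (Set.range fun i : Fin m => Equiv.swap i.castSucc i.succ) := by
    rw [Equiv.Perm.mclosure_swap_castSucc_succ]; trivial
  induction hx using Submonoid.closure_induction with
  | mem x hx =>
    obtain ⟨i, rfl⟩ := hx
    exact ⟨PresentedGroup.of i.castSucc, by rw [sigma_of, Fin.coeSucc_eq_succ]⟩
  | one => exact ⟨1, map_one _⟩
  | mul x y _ _ hx hy =>
    obtain ⟨g, rfl⟩ := hx
    obtain ⟨h, rfl⟩ := hy
    exact ⟨g * h, map_mul _ _ _⟩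

theorem exists_sigma_eq {r s p q : Fin n} (hrs : r ≠ s) (hpq : p ≠ q) :
    ∃ g, sigma n g r = p ∧ sigma n g s = q := by
  obtain ⟨g, hg⟩ := sigma_surjective (Equiv.swap (Equiv.swap r p s) q * Equiv.swap r p)
  have h : Equiv.swap r p s ≠ p := fun h => hrs
    ((Equiv.swap r p).injective (by rw [h, Equiv.swap_apply_left]))
  refine ⟨g, ?_, ?_⟩
  · rw [hg, Equiv.Perm.mul_apply, Equiv.swap_apply_left,
      Equiv.swap_apply_of_ne_of_ne h.symm hpq]
  · rw [hg, Equiv.Perm.mul_apply, Equiv.swap_apply_left]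

variable {M : Type*} [AddCommGroup M]

/-- Every homomorphism from `H` to an abelian group is given by weights. -/
theorem exists_weights_hom (hn : 4 < n) (f : H n →* Multiplicative M) :
    ∃ W : Weights M, f = (W.isCocycle hn).hom hn := by
  classical
  let x : Set (Fin n) := {Fin.ofNat n 1, Fin.ofNat n 2}
  have h12 := ofNat_one_ne_two hn
  -- Coset representatives are indexed by sets rather than ordered pairs, so the resulting cocycle
  -- is symmetric by construction. Sets that are not pairs receive the dummy value 1.
  have hs : ∀ S : Set (Fin n), ∃ g : PolygonGroup n,
      (∃ p q, p ≠ q ∧ S = {p, q}) → sigma n g • x = S := by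
    intro S
    by_cases h : ∃ p q, p ≠ q ∧ S = {p, q}
    · obtain ⟨p, q, hpq, rfl⟩ := h
      obtain ⟨g, hg1, hg2⟩ := exists_sigma_eq h12 hpq
      refine ⟨g, fun _ => ?_⟩
      rw [← Set.image_smul, Set.image_pair, Equiv.Perm.smul_def, Equiv.Perm.smul_def, hg1, hg2]
    · exact ⟨1, fun h' => absurd h' h⟩
  choose s hs using hs
  have hpair : ∀ (g : PolygonGroup n) (p q : Fin n),
      sigma n g • ({p, q} : Set (Fin n)) = {sigma n g p, sigma n g q} := fun g p q => by
    rw [← Set.image_smul, Set.image_pair, Equiv.Perm.smul_def, Equiv.Perm.smul_def]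
  have hH : ∀ g : PolygonGroup n, g ∈ H n ↔ sigma n g • x = x := fun g => by
    rw [mem_H_iff, ← hpair]
  have hs' : ∀ p q, p ≠ q → sigma n (s {p, q}) • x = {p, q} := fun p q h => hs _ ⟨p, q, h, rfl⟩
  let k : PolygonGroup n → Fin n → Fin n → PolygonGroup n := fun g p q =>
    (s {sigma n g p, sigma n g q})⁻¹ * g * s {p, q}
  have hk : ∀ g p q, p ≠ q → k g p q ∈ H n := fun g p q hpq => by
    rw [hH, map_mul, map_mul, mul_smul, hs' _ _ hpq, mul_smul, hpair, map_inv, inv_smul_eq_iff,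
      hs' _ _ ((sigma n g).injective.ne hpq)]
  let F : PolygonGroup n → M := fun g =>
    if h : g ∈ H n then Multiplicative.toAdd (f ⟨g, h⟩) else 0
  have hF : ∀ g h, g ∈ H n → h ∈ H n → F (g * h) = F g + F h := fun g h hg hh => by
    simp only [F]
    rw [dif_pos hg, dif_pos hh, dif_pos (mul_mem hg hh), ← toAdd_mul, ← map_mul]
    rfl
  have hc : IsCocycle fun g p q => F (k g p q) :=
    { mul := fun g h p q hpq => by
        rw [← hF _ _ (hk _ _ _ ((sigma n h).injective.ne hpq)) (hk _ _ _ hpq)]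
        simp only [k, map_mul, Equiv.Perm.mul_apply]
        congr 1
        group
      symm := fun g p q hpq => by
        simp only [k]
        rw [Set.pair_comm p q, Set.pair_comm (sigma n g p)] }
  obtain ⟨W, U, hU, hW⟩ := hc.exists_weights hn
  refine ⟨W, MonoidHom.ext fun h => ?_⟩
  rw [IsCocycle.hom_apply, ← hW _ _ _ h12]
  have hsx : s x ∈ H n := (hH _).2 (hs' _ _ h12)
  -- An element of `H` fixes the base pair, so the coboundary contributes nothing there.
  have e1 : U (sigma n h (Fin.ofNat n 1)) (sigma n h (Fin.ofNat n 2)) =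
      U (Fin.ofNat n 1) (Fin.ofNat n 2) :=
    eq_of_pair_eq (fun p q _ => hU p q) ((sigma n h).injective.ne h12) (mem_H_iff.1 h.2)
  -- The representative of the base pair need not be 1, but it lies in `H`, and conjugation by it is
  -- invisible in an abelian target.
  have e2 : F (k h (Fin.ofNat n 1) (Fin.ofNat n 2)) = F h := by
    have : k h (Fin.ofNat n 1) (Fin.ofNat n 2) = (s x)⁻¹ * h * s x := by
      simp only [k]
      rw [mem_H_iff.1 h.2]
    rw [this, hF _ _ (mul_mem (inv_mem hsx) h.2) hsx, hF _ _ (inv_mem hsx) h.2,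
      add_right_comm, ← hF _ _ (inv_mem hsx) hsx, inv_mul_cancel, add_eq_right]
    simp only [F]
    rw [dif_pos (one_mem _)]
    exact toAdd_eq_zero.2 (map_one f)
  rw [e1, e2, add_sub_cancel_right]
  simp only [F]
  rw [dif_pos h.2]
  rfl

end Transversal
-- The two halves of the conjugator and their permutations
section Words

variable (n : ℕ) [NeZero n]

/-- The product `aₖ ⋯ aₗ₋₁`. -/
def upWord (k l : ℕ) : PolygonGroup n := ((List.Ico k l).map (a n)).prod

/-- The product `aₖ⁻¹ ⋯ aₗ₋₁⁻¹`. -/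
def downWord (k l : ℕ) : PolygonGroup n := ((List.Ico k l).map fun i => (a n i)⁻¹).prod

variable {n}

theorem upWord_self (k : ℕ) : upWord n k k = 1 := by simp [upWord]

theorem upWord_succ {k l : ℕ} (h : k ≤ l) : upWord n k (l + 1) = upWord n k l * a n l := by
  simp [upWord, List.Ico.succ_top h]

theorem downWord_self (k : ℕ) : downWord n k k = 1 := by simp [downWord]

theorem downWord_succ {k l : ℕ} (h : k ≤ l) :
    downWord n k (l + 1) = downWord n k l * (a n l)⁻¹ := by
  simp [downWord, List.Ico.succ_top h]

theorem sigma_a_inv (i : ℕ) : sigma n (a n i)⁻¹ = sigma n (a n i) := by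
  rw [map_inv, sigma_a, Equiv.swap_inv]

theorem sigma_downWord {k l : ℕ} (h : k ≤ l) :
    sigma n (downWord n k l) = sigma n (upWord n k l) := by
  induction l, h using Nat.le_induction with
  | base => rw [upWord_self, downWord_self]
  | succ l h ih => rw [upWord_succ h, downWord_succ h, map_mul, map_mul, ih, sigma_a_inv]

theorem sigma_a_of_ne {i p : ℕ} (hi : 1 ≤ i) (hin : i < n) (hp : 1 ≤ p) (hpn : p ≤ n) (h : p ≠ i)
    (h' : p ≠ i + 1) : sigma n (a n i) (Fin.ofNat n p) = Fin.ofNat n p := by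
  rcases Nat.lt_or_gt_of_ne h with h | h
  · exact sigma_a_of_lt h (by omega)
  · exact sigma_a_of_gt (by omega) (by omega)

theorem sigma_upWord_out {k l p : ℕ} (hk : 1 ≤ k) (hkl : k ≤ l) (hl : l ≤ n) (hp : 1 ≤ p)
    (hpn : p ≤ n) (h : p < k ∨ l < p) :
    sigma n (upWord n k l) (Fin.ofNat n p) = Fin.ofNat n p := by
  induction l, hkl using Nat.le_induction with
  | base => simp [upWord_self]
  | succ l hkl ih =>
    rw [upWord_succ hkl, map_mul, Equiv.Perm.mul_apply,
      sigma_a_of_ne (by omega) (by omega) hp hpn (by omega) (by omega),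
      ih (by omega) (by omega)]

theorem sigma_upWord_down {k l : ℕ} (hkl : k ≤ l) (hl : l ≤ n) :
    sigma n (upWord n k l) (Fin.ofNat n l) = Fin.ofNat n k := by
  induction l, hkl using Nat.le_induction with
  | base => simp [upWord_self]
  | succ l hkl ih =>
    rw [upWord_succ hkl, map_mul, Equiv.Perm.mul_apply, sigma_a_right, ih (by omega)]

theorem sigma_upWord_up {k l m : ℕ} (hk : 1 ≤ k) (hkm : k ≤ m) (hml : m < l) (hl : l ≤ n) :
    sigma n (upWord n k l) (Fin.ofNat n m) = Fin.ofNat n (m + 1) := by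
  induction l, hml using Nat.le_induction with
  | base =>
    rw [upWord_succ hkm, map_mul, Equiv.Perm.mul_apply, sigma_a_left,
      sigma_upWord_out hk hkm (by omega) (by omega) (by omega) (by omega)]
  | succ l hml ih =>
    rw [upWord_succ (by omega), map_mul, Equiv.Perm.mul_apply,
      sigma_a_of_ne (by omega) (by omega) (by omega) (by omega) (by omega) (by omega),
      ih (by omega)]

end Words

/-! ### Values of weight cocycles on these words -/

section WordValues

variable {n : ℕ} [NeZero n] {M : Type*} [AddCommGroup M]

namespace Weights

variable (W : Weights M) (hn : 4 < n)

theorem ofNat_eq_iff {p q : ℕ} (hp : 1 ≤ p) (hpn : p ≤ n) (hq : 1 ≤ q) (hqn : q ≤ n) :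
    Fin.ofNat n p = Fin.ofNat n q ↔ p = q := by
  refine ⟨fun h => ?_, fun h => h ▸ rfl⟩
  have := congrArg rep h
  rwa [rep_ofNat hp hpn, rep_ofNat hq hqn] at this

theorem cocycle_a {i p q : ℕ} (hi : 1 ≤ i) (hin : i < n) (hp : 1 ≤ p) (hpn : p ≤ n) (hq : 1 ≤ q)
    (hqn : q ≤ n) : W.cocycle hn (a n i) (Fin.ofNat n p) (Fin.ofNat n q) =
      pairWeight W 0 i (i + 1) p q := by
  have h0 : W.shift (Fin.ofNat n i) = 0 := by
    refine if_neg fun h => ?_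
    have : i % n = 0 := by simpa [Fin.ofNat] using congrArg Fin.val h
    rw [Nat.mod_eq_of_lt hin] at this
    omega
  rw [a, cocycle_of, ← ofNat_succ, h0]
  unfold pairWeight
  simp only [ofNat_eq_iff hp hpn hi hin.le, ofNat_eq_iff hp hpn (by omega : 1 ≤ i + 1) hin,
    ofNat_eq_iff hq hqn hi hin.le, ofNat_eq_iff hq hqn (by omega : 1 ≤ i + 1) hin]

theorem cocycle_a_far {i p q : ℕ} (hi : 1 ≤ i) (hin : i < n) (hp : 1 ≤ p) (hpn : p ≤ n)
    (hq : 1 ≤ q) (hqn : q ≤ n) (h1 : p ≠ i) (h2 : p ≠ i + 1) (h3 : q ≠ i) (h4 : q ≠ i + 1) :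
    W.cocycle hn (a n i) (Fin.ofNat n p) (Fin.ofNat n q) = W.far := by
  rw [cocycle_a W hn hi hin hp hpn hq hqn]
  simp [pairWeight, *]

theorem cocycle_a_up {i q : ℕ} (hi : 1 ≤ i) (hin : i < n) (hq : 1 ≤ q) (hqn : q ≤ n)
    (h4 : q ≠ i + 1) : W.cocycle hn (a n i) (Fin.ofNat n i) (Fin.ofNat n q) = 0 := by
  rw [cocycle_a W hn hi hin hi hin.le hq hqn]
  simp [pairWeight, *]

theorem cocycle_a_down {i q : ℕ} (hi : 1 ≤ i) (hin : i < n) (hq : 1 ≤ q) (hqn : q ≤ n)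
    (h3 : q ≠ i) : W.cocycle hn (a n i) (Fin.ofNat n (i + 1)) (Fin.ofNat n q) = W.link := by
  rw [cocycle_a W hn hi hin (by omega) hin hq hqn]
  simp [pairWeight, *]

theorem cocycle_a_both {i : ℕ} (hi : 1 ≤ i) (hin : i < n) :
    W.cocycle hn (a n i) (Fin.ofNat n (i + 1)) (Fin.ofNat n i) = W.both := by
  rw [cocycle_a W hn hi hin (by omega) hin hi hin.le]
  simp [pairWeight]

theorem cocycle_a_both' {i : ℕ} (hi : 1 ≤ i) (hin : i < n) :
    W.cocycle hn (a n i) (Fin.ofNat n i) (Fin.ofNat n (i + 1)) = W.both := by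
  rw [cocycle_a W hn hi hin hi hin.le (by omega) hin]
  simp [pairWeight]

theorem cocycle_last_up {q : ℕ} (hq : 2 ≤ q) (hqn : q < n) :
    W.cocycle hn (a n n) (Fin.ofNat n n) (Fin.ofNat n q) = W.wind := by
  have h0 : Fin.ofNat n n = 0 := Fin.ext (by simp [Fin.ofNat])
  have h1 : Fin.ofNat n q ≠ 0 + 1 := by
    rw [← h0, ← ofNat_succ]; exact ofNat_ne (by omega) (by omega)
  rw [a, cocycle_of, h0]
  simp only [pairWeight, shift, if_neg h1, if_true]

theorem cocycle_last_down {q : ℕ} (hq : 2 ≤ q) (hqn : q < n) :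
    W.cocycle hn (a n n) (Fin.ofNat n 1) (Fin.ofNat n q) = W.link - W.wind := by
  have h0 : Fin.ofNat n n = 0 := Fin.ext (by simp [Fin.ofNat])
  have h1 : Fin.ofNat n q ≠ 0 := by
    rw [← h0]; exact ofNat_ne (by omega) (by omega)
  have h2 : Fin.ofNat n 1 = 0 + 1 := by rw [← h0, ← ofNat_succ, add_comm, ofNat_add_self]
  have h3 : (0 + 1 : Fin n) ≠ 0 := by rw [zero_add]; exact fin_one_ne_zero hn
  rw [a, cocycle_of, h0, h2]
  simp only [pairWeight, shift, if_neg h1, if_neg h3, if_true]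

theorem cocycle_inv_a (i : ℕ) (p q : Fin n) (hpq : p ≠ q) : W.cocycle hn (a n i)⁻¹ p q =
    -W.cocycle hn (a n i) (sigma n (a n i) p) (sigma n (a n i) q) := by
  rw [(W.isCocycle hn).inv _ hpq, sigma_a_inv]

variable {k l : ℕ}

theorem cocycle_upWord_out {p q : ℕ} (hk : 1 ≤ k) (hkl : k ≤ l) (hl : l ≤ n) (hp : 1 ≤ p) (hpn : p ≤ n)
    (hq : 1 ≤ q) (hqn : q ≤ n) (hp' : p < k ∨ l < p) (hq' : q < k ∨ l < q) :
    W.cocycle hn (upWord n k l) (Fin.ofNat n p) (Fin.ofNat n q) = ((l : ℤ) - k) • W.far := by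
  induction l, hkl using Nat.le_induction with
  | base => simp [upWord_self, cocycle]
  | succ l hkl ih =>
    rw [upWord_succ hkl, cocycle_mul,
      sigma_a_of_ne (by omega) (by omega) hp hpn (by omega) (by omega),
      sigma_a_of_ne (by omega) (by omega) hq hqn (by omega) (by omega),
      ih (by omega) (by omega) (by omega),
      cocycle_a_far W hn (by omega) (by omega) hp hpn hq hqn (by omega) (by omega) (by omega)
        (by omega)]
    push_cast
    module

theorem cocycle_upWord_down {q : ℕ} (hk : 1 ≤ k) (hkl : k ≤ l) (hl : l ≤ n)
    (hq : 1 ≤ q) (hqn : q ≤ n) (hq' : q < k ∨ l < q) :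
    W.cocycle hn (upWord n k l) (Fin.ofNat n l) (Fin.ofNat n q) = ((l : ℤ) - k) • W.link := by
  induction l, hkl using Nat.le_induction with
  | base => simp [upWord_self, cocycle]
  | succ l hkl ih =>
    rw [upWord_succ hkl, cocycle_mul, sigma_a_right,
      sigma_a_of_ne (by omega) (by omega) hq hqn (by omega) (by omega),
      ih (by omega) (by omega), cocycle_a_down W hn (by omega) (by omega) hq hqn (by omega)]
    push_cast
    module

theorem cocycle_upWord_up {m q : ℕ} (hk : 1 ≤ k) (hkm : k ≤ m) (hml : m < l) (hl : l ≤ n)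
    (hq : 1 ≤ q) (hqn : q ≤ n) (hq' : q < k ∨ l < q) :
    W.cocycle hn (upWord n k l) (Fin.ofNat n m) (Fin.ofNat n q) = ((l : ℤ) - k - 1) • W.far := by
  induction l, hml using Nat.le_induction with
  | base =>
    rw [upWord_succ hkm, cocycle_mul, sigma_a_left,
      sigma_a_of_ne (by omega) (by omega) hq hqn (by omega) (by omega),
      cocycle_upWord_out W hn hk hkm (by omega) (by omega) (by omega) hq hqn (by omega) (by omega),
      cocycle_a_up W hn (by omega) (by omega) hq hqn (by omega)]
    push_cast
    module
  | succ l hml ih =>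
    rw [upWord_succ (by omega), cocycle_mul,
      sigma_a_of_ne (by omega) (by omega) (by omega) (by omega) (by omega) (by omega),
      sigma_a_of_ne (by omega) (by omega) hq hqn (by omega) (by omega),
      ih (by omega) (by omega),
      cocycle_a_far W hn (by omega) (by omega) (by omega) (by omega) hq hqn (by omega) (by omega)
        (by omega) (by omega)]
    push_cast
    module

/-- The word carries the point `l` down to `k` one step per letter. It exchanges places with the
other point exactly once, at the letter `m`; every other letter is a downward move. -/
theorem cocycle_upWord_pair {m : ℕ} (hk : 1 ≤ k) (hkm : k ≤ m) (hml : m < l) (hl : l ≤ n) :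
    W.cocycle hn (upWord n k l) (Fin.ofNat n l) (Fin.ofNat n m) =
      ((l : ℤ) - k - 1) • W.link + W.both := by
  induction l, hml using Nat.le_induction with
  | base =>
    rw [upWord_succ hkm, cocycle_mul, sigma_a_left, sigma_a_right,
      cocycle_upWord_down W hn hk hkm (by omega) (by omega) (by omega) (by omega),
      cocycle_a_both W hn (by omega) (by omega)]
    push_cast
    module
  | succ l hml ih =>
    rw [upWord_succ (by omega), cocycle_mul, sigma_a_right,
      sigma_a_of_ne (by omega) (by omega) (by omega) (by omega) (by omega) (by omega),
      ih (by omega), cocycle_a_down W hn (by omega) (by omega) (by omega) (by omega) (by omega)]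
    push_cast
    module

theorem cocycle_downWord_out {p q : ℕ} (hk : 1 ≤ k) (hkl : k ≤ l) (hl : l ≤ n) (hp : 1 ≤ p) (hpn : p ≤ n)
    (hq : 1 ≤ q) (hqn : q ≤ n) (hp' : p < k ∨ l < p) (hq' : q < k ∨ l < q) (hpq : p ≠ q) :
    W.cocycle hn (downWord n k l) (Fin.ofNat n p) (Fin.ofNat n q) = -(((l : ℤ) - k) • W.far) := by
  have hne := (ofNat_eq_iff hp hpn hq hqn).not.2 hpq
  induction l, hkl using Nat.le_induction with
  | base => simp [downWord_self, cocycle]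
  | succ l hkl ih =>
    rw [downWord_succ hkl, cocycle_mul, sigma_a_inv, cocycle_inv_a _ _ _ _ _ hne,
      sigma_a_of_ne (by omega) (by omega) hp hpn (by omega) (by omega),
      sigma_a_of_ne (by omega) (by omega) hq hqn (by omega) (by omega),
      ih (by omega) (by omega) (by omega),
      cocycle_a_far W hn (by omega) (by omega) hp hpn hq hqn (by omega) (by omega) (by omega)
        (by omega)]
    push_cast
    module

theorem cocycle_downWord_down {q : ℕ} (hk : 1 ≤ k) (hkl : k ≤ l) (hl : l ≤ n)
    (hq : 1 ≤ q) (hqn : q ≤ n) (hq' : q < k ∨ l < q) :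
    W.cocycle hn (downWord n k l) (Fin.ofNat n l) (Fin.ofNat n q) = 0 := by
  induction l, hkl using Nat.le_induction with
  | base => simp [downWord_self, cocycle]
  | succ l hkl ih =>
    rw [downWord_succ hkl, cocycle_mul, sigma_a_inv,
      cocycle_inv_a _ _ _ _ _ ((ofNat_eq_iff (by omega) hl hq hqn).not.2 (by omega)),
      sigma_a_right, sigma_a_of_ne (by omega) (by omega) hq hqn (by omega) (by omega),
      ih (by omega) (by omega), cocycle_a_up W hn (by omega) (by omega) hq hqn (by omega)]
    simp

/-- The point is raised only by the inverse of the generator `m`, which undoes a downward move and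
so costs `-link`; all other letters act away from the pair. -/
theorem cocycle_downWord_up {m q : ℕ} (hk : 1 ≤ k) (hkm : k ≤ m) (hml : m < l) (hl : l ≤ n)
    (hq : 1 ≤ q) (hqn : q ≤ n) (hq' : q < k ∨ l < q) :
    W.cocycle hn (downWord n k l) (Fin.ofNat n m) (Fin.ofNat n q) =
      -(((l : ℤ) - k - 1) • W.far) - W.link := by
  have hne := (ofNat_eq_iff (n := n) (p := m) (q := q) (by omega) (by omega) hq hqn).not.2
    (by omega)
  induction l, hml using Nat.le_induction with
  | base =>
    rw [downWord_succ hkm, cocycle_mul, sigma_a_inv, cocycle_inv_a _ _ _ _ _ hne, sigma_a_left,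
      sigma_a_of_ne (by omega) (by omega) hq hqn (by omega) (by omega),
      cocycle_downWord_out W hn hk hkm (by omega) (by omega) (by omega) hq hqn (by omega) (by omega)
        (by omega), cocycle_a_down W hn (by omega) (by omega) hq hqn (by omega)]
    push_cast
    module
  | succ l hml ih =>
    rw [downWord_succ (by omega), cocycle_mul, sigma_a_inv, cocycle_inv_a _ _ _ _ _ hne,
      sigma_a_of_ne (by omega) (by omega) (by omega) (by omega) (by omega) (by omega),
      sigma_a_of_ne (by omega) (by omega) hq hqn (by omega) (by omega),
      ih (by omega) (by omega),
      cocycle_a_far W hn (by omega) (by omega) (by omega) (by omega) hq hqn (by omega) (by omega)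
        (by omega) (by omega)]
    push_cast
    module

/-- Descending by an inverse generator undoes a free upward move, so only the single exchange of the
two points contributes. -/
theorem cocycle_downWord_pair {m : ℕ} (hk : 1 ≤ k) (hkm : k ≤ m) (hml : m < l) (hl : l ≤ n) :
    W.cocycle hn (downWord n k l) (Fin.ofNat n l) (Fin.ofNat n m) = -W.both := by
  have hne := (ofNat_eq_iff (n := n) (p := l) (q := m) (by omega) (by omega) (by omega)
    (by omega)).not.2 (by omega)
  induction l, hml using Nat.le_induction with
  | base =>
    rw [downWord_succ hkm, cocycle_mul, sigma_a_inv, cocycle_inv_a _ _ _ _ _ hne, sigma_a_left,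
      sigma_a_right,
      cocycle_downWord_down W hn hk hkm (by omega) (by omega) (by omega) (by omega),
      cocycle_a_both' W hn (by omega) (by omega)]
    simp
  | succ l hml ih =>
    rw [downWord_succ (by omega), cocycle_mul, sigma_a_inv, cocycle_inv_a _ _ _ _ _ hne,
      sigma_a_right,
      sigma_a_of_ne (by omega) (by omega) (by omega) (by omega) (by omega) (by omega),
      ih (by omega) ((ofNat_eq_iff (by omega) (by omega) (by omega) (by omega)).not.2 (by omega)),
      cocycle_a_up W hn (by omega) (by omega) (by omega) (by omega) (by omega)]
    simp

end Weights
end WordValues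
-- Values of the twisted cycle commutators
section Commutator

variable {n : ℕ} [NeZero n]

/-- The conjugator `a₂⁻¹ ⋯ aₜ₊₁⁻¹ aₜ₊₂ ⋯ aₙ₋₁` of the twisted cycle commutator. -/
def twistedWord (n : ℕ) [NeZero n] (t : ℕ) : PolygonGroup n :=
  downWord n 2 (t + 2) * upWord n (t + 2) n

theorem twistedCycleCommutator_eq (t : ℕ) : twistedCycleCommutator n t (a n) =
    ⁅a n 1, twistedWord n t * a n n * (twistedWord n t)⁻¹⁆ := rfl

theorem cycleCommutator_eq : cycleCommutator n (a n) = twistedCycleCommutator n 0 (a n) := by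
  simp [cycleCommutator, twistedCycleCommutator]

theorem sigma_twistedWord {t : ℕ} (ht : t + 3 ≤ n) :
    sigma n (twistedWord n t) (Fin.ofNat n 1) = Fin.ofNat n 1 ∧
    sigma n (twistedWord n t) (Fin.ofNat n n) = Fin.ofNat n 2 ∧
    ∀ m, 2 ≤ m → m < n → sigma n (twistedWord n t) (Fin.ofNat n m) = Fin.ofNat n (m + 1) := by
  simp only [twistedWord, map_mul, Equiv.Perm.mul_apply,
    sigma_downWord (n := n) (show 2 ≤ t + 2 by omega)]
  refine ⟨?_, ?_, fun m h1 h2 => ?_⟩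
  · rw [sigma_upWord_out (by omega) (by omega) le_rfl le_rfl (by omega) (by omega),
      sigma_upWord_out (by omega) (by omega) (by omega) le_rfl (by omega) (by omega)]
  · rw [sigma_upWord_down (by omega) le_rfl, sigma_upWord_down (by omega) (by omega)]
  · by_cases h : t + 2 ≤ m
    · rw [sigma_upWord_up (by omega) h h2 le_rfl,
        sigma_upWord_out (by omega) (by omega) (by omega) (by omega) (by omega) (by omega)]
    · rw [sigma_upWord_out (by omega) (by omega) le_rfl (by omega) (by omega) (by omega),
        sigma_upWord_up (by omega) h1 (by omega) (by omega)]

/-- The conjugator fixes 1 and sends `n` to 2, so both entries of the commutator act as the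
transposition of 1 and 2. -/
theorem sigma_conj_a_last {t : ℕ} (ht : t + 3 ≤ n) :
    sigma n (twistedWord n t * a n n * (twistedWord n t)⁻¹) = sigma n (a n 1) := by
  obtain ⟨h1, h2, -⟩ := sigma_twistedWord ht
  rw [map_mul, map_mul, map_inv, sigma_a n, add_comm n 1, ofNat_add_self,
    ← Equiv.swap_apply_apply, h1, h2, sigma_a, Equiv.swap_comm]

theorem sigma_twistedCycleCommutator {t : ℕ} (ht : t + 3 ≤ n) :
    sigma n (twistedCycleCommutator n t (a n)) = 1 := by
  rw [twistedCycleCommutator_eq, map_commutatorElement, sigma_conj_a_last ht,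
    commutatorElement_self]

variable {M : Type*} [AddCommGroup M]

/-- Because `g` and `h` induce the same involution, `h * g` acts trivially, and comparing `g * h`
with `h * g` isolates the commutator. -/
theorem IsCocycle.commutator {c : PolygonGroup n → Fin n → Fin n → M} (hc : IsCocycle c)
    {g h : PolygonGroup n} (hgh : sigma n g = sigma n h) (hg : sigma n g * sigma n g = 1)
    {p q : Fin n} (hpq : p ≠ q) :
    c ⁅g, h⁆ p q = c g (sigma n g p) (sigma n g q) + c h p q -
      (c h (sigma n g p) (sigma n g q) + c g p q) := by
  have e : ⁅g, h⁆ * (h * g) = g * h := by rw [commutatorElement_def]; group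
  have e := congrArg (fun x => c x p q) e
  have h1 : sigma n (h * g) = 1 := by rw [map_mul, ← hgh, hg]
  rw [hc.mul _ _ _ _ hpq, hc.mul _ _ _ _ hpq, hc.mul _ _ _ _ hpq, h1, ← hgh] at e
  rw [← e]
  simp

namespace Weights

/-- Half the value of a twisted cycle commutator at `{1, m + 1}`, for `m ≥ t + 2`. -/
def upDefect (W : Weights M) (n t : ℕ) : M :=
  W.link - W.wind + ((n : ℤ) - 3 - t) • W.link + W.both - ((n : ℤ) - 3 - 2 * t) • W.far

/-- Half the value of a twisted cycle commutator at `{1, m + 1}`, for `m ≤ t + 1`. -/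
def downDefect (W : Weights M) (n t : ℕ) : M :=
  W.link - W.wind + ((n : ℤ) - 1 - t) • W.link - W.both - ((n : ℤ) - 1 - 2 * t) • W.far

variable (W : Weights M) (hn : 4 < n)

theorem cocycle_twistedWord_one {t m : ℕ} (ht : t + 3 ≤ n) (hm : 2 ≤ m) (hmn : m < n) :
    W.cocycle hn (twistedWord n t) (Fin.ofNat n m) (Fin.ofNat n 1) =
      if t + 2 ≤ m then ((n : ℤ) - 3 - 2 * t) • W.far
      else ((n : ℤ) - 1 - 2 * t) • W.far - W.link := by
  rw [twistedWord, cocycle_mul,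
    sigma_upWord_out (p := 1) (by omega) (by omega) le_rfl le_rfl (by omega) (by omega)]
  split_ifs with h
  · rw [sigma_upWord_up (by omega) h hmn le_rfl,
      cocycle_upWord_up W hn (by omega) h hmn le_rfl le_rfl (by omega) (by omega),
      cocycle_downWord_out W hn (by omega) (by omega) (by omega) (by omega) (by omega) le_rfl
        (by omega) (by omega) (by omega) (by omega)]
    push_cast
    module
  · rw [sigma_upWord_out (by omega) (by omega) le_rfl (by omega) (by omega) (by omega),
      cocycle_upWord_out W hn (by omega) (by omega) le_rfl (by omega) (by omega) le_rfl (by omega)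
        (by omega) (by omega),
      cocycle_downWord_up W hn (by omega) hm (by omega) (by omega) le_rfl (by omega) (by omega)]
    push_cast
    module

theorem cocycle_twistedWord_last {t m : ℕ} (ht : t + 3 ≤ n) (hm : 2 ≤ m) (hmn : m < n) :
    W.cocycle hn (twistedWord n t) (Fin.ofNat n n) (Fin.ofNat n m) =
      if t + 2 ≤ m then ((n : ℤ) - 3 - t) • W.link + W.both
      else ((n : ℤ) - 2 - t) • W.link - W.both := by
  rw [twistedWord, cocycle_mul, sigma_upWord_down (by omega) le_rfl]
  split_ifs with h
  · rw [sigma_upWord_up (by omega) h hmn le_rfl,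
      cocycle_upWord_pair W hn (by omega) h hmn le_rfl,
      cocycle_downWord_down W hn (by omega) (by omega) (by omega) (by omega) (by omega)
        (by omega)]
    push_cast
    module
  · rw [sigma_upWord_out (by omega) (by omega) le_rfl (by omega) (by omega) (by omega),
      cocycle_upWord_down W hn (by omega) (by omega) le_rfl (by omega) (by omega) (by omega),
      cocycle_downWord_pair W hn (by omega) hm (by omega) (by omega)]
    push_cast
    module

theorem cocycle_conj_a_last {t m : ℕ} (ht : t + 3 ≤ n) (hm : 2 ≤ m) (hmn : m < n) :
    W.cocycle hn (twistedWord n t * a n n * (twistedWord n t)⁻¹) (Fin.ofNat n 1)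
        (Fin.ofNat n (m + 1)) =
      W.cocycle hn (twistedWord n t) (Fin.ofNat n n) (Fin.ofNat n m) + (W.link - W.wind) -
        W.cocycle hn (twistedWord n t) (Fin.ofNat n m) (Fin.ofNat n 1) ∧
    W.cocycle hn (twistedWord n t * a n n * (twistedWord n t)⁻¹) (Fin.ofNat n 2)
        (Fin.ofNat n (m + 1)) =
      W.cocycle hn (twistedWord n t) (Fin.ofNat n m) (Fin.ofNat n 1) + W.wind -
        W.cocycle hn (twistedWord n t) (Fin.ofNat n n) (Fin.ofNat n m) := by
  obtain ⟨h1, h2, h3⟩ := sigma_twistedWord ht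
  have h3 := h3 m hm hmn
  have hne : Fin.ofNat n m ≠ Fin.ofNat n 1 := ofNat_ne' (by omega) (by omega)
  set v := twistedWord n t
  -- Evaluating this identity, rather than the conjugate itself, avoids any value of the inverse of
  -- `v`.
  have e : v * a n n * v⁻¹ * v = v * a n n := by group
  have s1 : sigma n (a n n) (Fin.ofNat n 1) = Fin.ofNat n n := by
    have := sigma_a_right (n := n) n
    rwa [add_comm n 1, ofNat_add_self] at this
  have s2 : sigma n (a n n) (Fin.ofNat n n) = Fin.ofNat n 1 := by
    have := sigma_a_left (n := n) n
    rwa [add_comm n 1, ofNat_add_self] at this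
  have s3 : sigma n (a n n) (Fin.ofNat n m) = Fin.ofNat n m := sigma_a_of_lt hmn (by omega)
  have e1 := congrArg (fun x => W.cocycle hn x (Fin.ofNat n 1) (Fin.ofNat n m)) e
  have e2 := congrArg (fun x => W.cocycle hn x (Fin.ofNat n n) (Fin.ofNat n m)) e
  rw [cocycle_mul, h1, h3, cocycle_mul _ _ v, s1, s3, cocycle_last_down W hn hm hmn] at e1
  rw [cocycle_mul, h2, h3, cocycle_mul _ _ v, s2, s3, cocycle_last_up W hn hm hmn] at e2
  rw [(W.isCocycle hn).symm v _ _ hne]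
  exact ⟨eq_sub_of_add_eq e1, eq_sub_of_add_eq e2⟩

theorem cocycle_twistedCycleCommutator_one {t m : ℕ} (ht : t + 3 ≤ n) (hm : 2 ≤ m) (hmn : m < n) :
    W.cocycle hn (twistedCycleCommutator n t (a n)) (Fin.ofNat n 1) (Fin.ofNat n (m + 1)) =
      (2 : ℤ) • (if t + 2 ≤ m then W.upDefect n t else W.downDefect n t) ∧
    W.cocycle hn (twistedCycleCommutator n t (a n)) (Fin.ofNat n 2) (Fin.ofNat n (m + 1)) =
      -((2 : ℤ) • (if t + 2 ≤ m then W.upDefect n t else W.downDefect n t)) := by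
  have hg : sigma n (a n 1) * sigma n (a n 1) = 1 := by rw [sigma_a, Equiv.swap_mul_self]
  have s3 : sigma n (a n 1) (Fin.ofNat n (m + 1)) = Fin.ofNat n (m + 1) :=
    sigma_a_of_gt (by omega) (by omega)
  obtain ⟨h1, h2⟩ := cocycle_conj_a_last W hn ht hm hmn
  rw [cocycle_twistedWord_one W hn ht hm hmn, cocycle_twistedWord_last W hn ht hm hmn] at h1 h2
  have u := cocycle_a_up W hn (i := 1) (q := m + 1) le_rfl (by omega) (by omega) (by omega)
    (by omega)
  have d := cocycle_a_down W hn (i := 1) (q := m + 1) le_rfl (by omega) (by omega) (by omega)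
    (by omega)
  rw [one_add_one_eq_two] at d
  have s1 := sigma_a_left (n := n) 1
  have s2 := sigma_a_right (n := n) 1
  rw [one_add_one_eq_two] at s1 s2
  rw [twistedCycleCommutator_eq,
    (W.isCocycle hn).commutator (sigma_conj_a_last ht).symm hg (ofNat_ne (by omega) (by omega)),
    (W.isCocycle hn).commutator (sigma_conj_a_last ht).symm hg (ofNat_ne (by omega) (by omega)),
    s1, s2, s3, h1, h2, u, d]
  unfold upDefect downDefect
  constructor <;> split_ifs <;> module

/-- On a pair preserved by the common involution, the commutator formula cancels term by term. -/
theorem cocycle_twistedCycleCommutator_of_fixed {t : ℕ} (ht : t + 3 ≤ n) {p q : Fin n}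
    (hpq : p ≠ q) (h : ({sigma n (a n 1) p, sigma n (a n 1) q} : Set (Fin n)) = {p, q}) :
    W.cocycle hn (twistedCycleCommutator n t (a n)) p q = 0 := by
  have hg : sigma n (a n 1) * sigma n (a n 1) = 1 := by rw [sigma_a, Equiv.swap_mul_self]
  have hc := W.isCocycle hn
  rw [twistedCycleCommutator_eq, hc.commutator (sigma_conj_a_last ht).symm hg hpq,
    eq_of_pair_eq (hc.symm _) ((sigma n (a n 1)).injective.ne hpq) h,
    eq_of_pair_eq (hc.symm _) ((sigma n (a n 1)).injective.ne hpq) h]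
  abel

theorem cocycle_twistedCycleCommutator_eq_zero {t : ℕ} (ht : t + 3 ≤ n)
    (hup : (2 : ℤ) • W.upDefect n t = 0) (hdown : t ≠ 0 → (2 : ℤ) • W.downDefect n t = 0)
    {p q : Fin n} (hpq : p ≠ q) : W.cocycle hn (twistedCycleCommutator n t (a n)) p q = 0 := by
  have key : ∀ m, 2 ≤ m → m < n →
      W.cocycle hn (twistedCycleCommutator n t (a n)) (Fin.ofNat n 1) (Fin.ofNat n (m + 1)) = 0 ∧
      W.cocycle hn (twistedCycleCommutator n t (a n)) (Fin.ofNat n 2) (Fin.ofNat n (m + 1)) = 0 := by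
    intro m hm hmn
    have : (2 : ℤ) • (if t + 2 ≤ m then W.upDefect n t else W.downDefect n t) = 0 := by
      split_ifs with h
      · exact hup
      · exact hdown (by omega)
    obtain ⟨h1, h2⟩ := cocycle_twistedCycleCommutator_one W hn ht hm hmn
    rw [h1, h2, this, neg_zero]
    exact ⟨rfl, rfl⟩
  obtain ⟨p, hp1, hp2, rfl⟩ := exists_ofNat_eq 1 p
  obtain ⟨q, hq1, hq2, rfl⟩ := exists_ofNat_eq 1 q
  wlog h : p < q generalizing p q
  · have hne : p ≠ q := fun e => hpq (e ▸ rfl)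
    rw [(W.isCocycle hn).symm _ _ _ hpq]
    exact this q hq1 hq2 p hp1 hp2 hpq.symm (by omega)
  have s1 := sigma_a_left (n := n) 1
  have s2 := sigma_a_right (n := n) 1
  rw [one_add_one_eq_two] at s1 s2
  by_cases hq : q = 2
  · obtain rfl : p = 1 := by omega
    subst hq
    refine cocycle_twistedCycleCommutator_of_fixed W hn ht hpq ?_
    rw [s1, s2, Set.pair_comm]
  obtain ⟨m, rfl⟩ := Nat.exists_eq_add_of_le' (show 1 ≤ q by omega)
  by_cases hp1' : p = 1
  · rw [hp1']; exact (key m (by omega) (by omega)).1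
  by_cases hp2' : p = 2
  · rw [hp2']; exact (key m (by omega) (by omega)).2
  refine cocycle_twistedCycleCommutator_of_fixed W hn ht hpq ?_
  rw [sigma_a_of_gt (by omega) (by omega), sigma_a_of_gt (by omega) (by omega)]

end Weights
end Commutator
-- The abelianization of `K` and `M` are both quotients of `H`; the hypotheses make the two kernels
-- coincide.
theorem nonempty_abelianization_addEquiv {H K M : Type*} [Group H] [Group K] [AddCommGroup M]
    {g : H →* K} (hg : Function.Surjective g) {φ : H →* Multiplicative M}
    (hφ : Function.Surjective φ) (hker : ∀ h, g h = 1 → φ h = 1)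
    (hof : ∀ h, φ h = 1 → Abelianization.of (g h) = 1) :
    Nonempty (Additive (Abelianization K) ≃+ M) := by
  let f : H →* Abelianization K := Abelianization.of.comp g
  have hf : Function.Surjective f := (QuotientGroup.mk'_surjective _).comp hg
  have hle : g.ker ≤ φ.ker := fun h hh => hker h hh
  let ψ : K →* Multiplicative M := g.liftOfSurjective hg ⟨φ, hle⟩
  have hψ : ∀ h, ψ (g h) = φ h := fun h => MonoidHom.liftOfRightInverse_comp_apply _ _ _ ⟨φ, hle⟩ h
  have hkk : f.ker = φ.ker := by
    ext h
    refine ⟨fun hh => ?_, fun hh => hof h hh⟩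
    have : Abelianization.lift ψ (Abelianization.of (g h)) = 1 := by
      rw [show Abelianization.of (g h) = 1 from hh, map_one]
    rwa [Abelianization.lift_apply_of, hψ] at this
  exact ⟨MulEquiv.toAdditiveLeft (((QuotientGroup.quotientKerEquivOfSurjective f hf).symm.trans
    (QuotientGroup.quotientMulEquivOfEq hkk)).trans
    (QuotientGroup.quotientKerEquivOfSurjective φ hφ))⟩

/-! ### Universal weights compute abelianizations -/

section Universal

variable {n : ℕ} [NeZero n] (hn : 4 < n) {M : Type*} [AddCommGroup M]

/-- The homomorphism `H → M` given by weights. -/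
def Weights.hom (W : Weights M) : H n →* Multiplicative M := (W.isCocycle hn).hom hn

theorem Weights.hom_eq_one_iff (W : Weights M) (h : H n) :
    W.hom hn h = 1 ↔ W.cocycle hn h (Fin.ofNat n 1) (Fin.ofNat n 2) = 0 := Iff.rfl

/-- Weights generate `M` if every subgroup containing them is everything. -/
def Weights.Generates (W : Weights M) : Prop :=
  ∀ S : AddSubgroup M, W.far ∈ S → W.both ∈ S → W.link ∈ S → W.wind ∈ S → ∀ m, m ∈ S

/-- Explicit elements of `H` realise the weights: `a n 3` gives `far`, `a n 1` gives `both`, the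
square of `a n 2` gives `link`, and a loop crossing the edge from `n` to 1 gives `wind` up to the
others. -/
theorem Weights.hom_surjective (W : Weights M) (hW : W.Generates) :
    Function.Surjective (W.hom (n := n) hn) := by
  let S : AddSubgroup M := AddMonoidHom.range (MonoidHom.toAdditiveLeft (W.hom (n := n) hn))
  have h12 := ofNat_one_ne_two hn
  have hS : ∀ g ∈ H n, W.cocycle hn g (Fin.ofNat n 1) (Fin.ofNat n 2) ∈ S :=
    fun g hg => ⟨Additive.ofMul ⟨g, hg⟩, rfl⟩
  have hc := W.isCocycle (n := n) hn
  have l1 : sigma n (a n 1) (Fin.ofNat n 1) = Fin.ofNat n 2 := sigma_a_left 1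
  have r1 : sigma n (a n 1) (Fin.ofNat n 2) = Fin.ofNat n 1 := sigma_a_right 1
  have l2 : sigma n (a n 2) (Fin.ofNat n 2) = Fin.ofNat n 3 := sigma_a_left 2
  have r2 : sigma n (a n 2) (Fin.ofNat n 3) = Fin.ofNat n 2 := sigma_a_right 2
  have g3 : ∀ k, 0 < k → k < 3 → sigma n (a n 3) (Fin.ofNat n k) = Fin.ofNat n k :=
    fun k h h' => sigma_a_of_lt h' (by omega)
  have f2 : sigma n (a n 2) (Fin.ofNat n 1) = Fin.ofNat n 1 :=
    sigma_a_of_lt (by omega) (by omega)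
  have f1 : sigma n (a n 1) (Fin.ofNat n 3) = Fin.ofNat n 3 :=
    sigma_a_of_gt (by omega) (by omega)
  have hfar : W.far ∈ S := by
    have := hS (a n 3) (mem_H_iff.2 (by rw [g3 1 (by omega) (by omega), g3 2 (by omega) (by omega)]))
    rwa [W.cocycle_a_far hn (by omega) (by omega) (by omega) (by omega) (by omega) (by omega)
      (by omega) (by omega) (by omega) (by omega)] at this
  have hboth : W.both ∈ S := by
    have := hS (a n 1) (mem_H_iff.2 (by rw [l1, r1, Set.pair_comm]))
    rwa [W.cocycle_a_both' hn (by omega) (by omega)] at this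
  have d2 : W.cocycle hn (a n 2) (Fin.ofNat n 3) (Fin.ofNat n 1) = W.link :=
    W.cocycle_a_down hn (by omega) (by omega) (by omega) (by omega) (by omega)
  have d1 : W.cocycle hn (a n 1) (Fin.ofNat n 2) (Fin.ofNat n 3) = W.link :=
    W.cocycle_a_down hn (by omega) (by omega) (by omega) (by omega) (by omega)
  have u2 : W.cocycle hn (a n 2) (Fin.ofNat n 2) (Fin.ofNat n 1) = 0 :=
    W.cocycle_a_up hn (by omega) (by omega) (by omega) (by omega) (by omega)
  have hlink : W.link ∈ S := by
    have := hS (a n 2 * a n 2) (mem_H_iff.2 (by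
      rw [map_mul, Equiv.Perm.mul_apply, Equiv.Perm.mul_apply, f2, f2, l2, r2]))
    rwa [W.cocycle_mul, f2, l2, hc.symm _ _ _ (ofNat_ne (by omega) (by omega)), d2,
      hc.symm _ _ _ h12, u2, add_zero] at this
  have hwind : W.wind ∈ S := by
    have s1 : sigma n (a n n) (Fin.ofNat n 1) = Fin.ofNat n n := by
      have := sigma_a_right (n := n) n
      rwa [add_comm n 1, ofNat_add_self] at this
    have s2 : sigma n (a n n) (Fin.ofNat n 2) = Fin.ofNat n 2 :=
      sigma_a_of_lt (by omega) (by omega)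
    obtain ⟨-, v1, v2⟩ := sigma_twistedWord (n := n) (t := 0) (by omega)
    have v2 : sigma n (twistedWord n 0) (Fin.ofNat n 2) = Fin.ofNat n 3 :=
      v2 2 le_rfl (by omega)
    -- The pair runs through `{1, 2}`, `{n, 2}`, `{2, 3}`, `{1, 3}`, `{1, 2}`: one point goes once
    -- around the polygon.
    have := hS (a n 2 * (a n 1 * (twistedWord n 0 * a n n))) (mem_H_iff.2 (by
      simp only [map_mul, Equiv.Perm.mul_apply]
      rw [s1, s2, v1, v2, r1, f1, f2, r2]))
    rw [W.cocycle_mul, W.cocycle_mul, W.cocycle_mul] at this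
    simp only [map_mul, Equiv.Perm.mul_apply] at this
    rw [s1, s2, v1, v2, r1, f1, hc.symm _ _ _ (ofNat_ne (by omega) (by omega)), d2, d1,
      W.cocycle_twistedWord_last hn (by omega) le_rfl (by omega), if_pos (by omega),
      W.cocycle_last_down hn le_rfl (by omega)] at this
    have h2 := S.add_mem (S.add_mem hlink (S.add_mem hlink
      (S.add_mem (S.add_mem (S.zsmul_mem hlink ((n : ℤ) - 3 - (0 : ℕ))) hboth) hlink)))
      (S.neg_mem this)
    convert h2 using 1
    abel
  intro m
  obtain ⟨h, hh⟩ := hW S hfar hboth hlink hwind m.toAdd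
  exact ⟨h.toMul, hh⟩

/-- The map from `H` to the abelianization of `K` is itself given by weights `W'`. If `W'` is an
image of `W`, naturality shows that this map kills everything killed by `W`. -/
theorem Weights.nonempty_addEquiv {K : Type*} [Group K] {g : H n →* K}
    (hg : Function.Surjective g) (W : Weights M) (hW : W.Generates)
    (hker : ∀ h, g h = 1 → W.hom hn h = 1)
    (huniv : ∀ W' : Weights (Additive (Abelianization K)),
      (∀ h, g h = 1 → W'.hom hn h = 1) →
        ∃ L : M →+ Additive (Abelianization K), W.map L = W') :
    Nonempty (Additive (Abelianization K) ≃+ M) := by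
  refine nonempty_abelianization_addEquiv hg (W.hom_surjective hn hW) hker fun h hh => ?_
  obtain ⟨W', hW'⟩ := exists_weights_hom hn (M := Additive (Abelianization K))
    (Abelianization.of.comp g)
  have hk : ∀ h, Abelianization.of (g h) = 1 ↔ W'.hom hn h = 1 := fun h => by
    rw [Weights.hom, ← hW']
    rfl
  obtain ⟨L, rfl⟩ := huniv W' fun h hh => (hk h).1 (by rw [hh, map_one])
  rw [hk, Weights.hom_eq_one_iff, ← W.map_cocycle L hn _ (ofNat_one_ne_two hn),
    (W.hom_eq_one_iff hn h).1 hh, map_zero]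

/-- A conjugator taking `{1, 2}` to `{p, q}` turns the value of `r` there into the value of a
conjugate of `r` at the base pair. -/
theorem Weights.cocycle_eq_zero_of_hom {r : PolygonGroup n} (hr : sigma n r = 1) (W : Weights M)
    (h : ∀ h : H n, (h : PolygonGroup n) ∈ Subgroup.normalClosure {r} → W.hom hn h = 1)
    {p q : Fin n} (hpq : p ≠ q) : W.cocycle hn r p q = 0 := by
  obtain ⟨x, rfl, rfl⟩ := exists_sigma_eq (ofNat_one_ne_two hn) hpq
  rw [← (W.isCocycle hn).conj hr x (ofNat_one_ne_two hn)]
  have hmem : x⁻¹ * r * x ∈ H n := mem_H_iff.2 (by simp [hr])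
  refine (W.hom_eq_one_iff hn ⟨_, hmem⟩).1 (h ⟨_, hmem⟩ ?_)
  have := Subgroup.normalClosure_normal.conj_mem r
    (Subgroup.subset_normalClosure (Set.mem_singleton r)) x⁻¹
  rwa [inv_inv] at this

/-- The abelianization of the image of `H` in the quotient by a twisted cycle commutator. -/
theorem Weights.nonempty_addEquiv_quotient (hn : 4 < n) {t : ℕ} (ht : t + 3 ≤ n) (W : Weights M)
    (hW : W.Generates) (hup : (2 : ℤ) • W.upDefect n t = 0)
    (hdown : t ≠ 0 → (2 : ℤ) • W.downDefect n t = 0)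
    (huniv : ∀ W' : Weights (Additive (Abelianization (Ht n t))),
      (2 : ℤ) • W'.upDefect n t = 0 → (t ≠ 0 → (2 : ℤ) • W'.downDefect n t = 0) →
        ∃ L : M →+ Additive (Abelianization (Ht n t)), W.map L = W') :
    Nonempty (Additive (Abelianization (Ht n t)) ≃+ M) := by
  let r := twistedCycleCommutator n t (a n)
  have hr : sigma n r = 1 := sigma_twistedCycleCommutator ht
  have hg : ∀ h : H n,
      (QuotientGroup.mk' (Subgroup.normalClosure {r})).subgroupMap (H n) h = 1 ↔
        (h : PolygonGroup n) ∈ Subgroup.normalClosure {r} := fun h => by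
    rw [← QuotientGroup.eq_one_iff]
    exact Subtype.ext_iff
  refine W.nonempty_addEquiv hn
    (g := (QuotientGroup.mk' (Subgroup.normalClosure {r})).subgroupMap (H n))
    (MonoidHom.subgroupMap_surjective _ _) hW (fun h hh => ?_) fun W' hW' => ?_
  · refine (W.hom_eq_one_iff hn h).2 (((W.isCocycle hn).conj_eq_zero hr ?_ ((hg h).1 hh)).2 _ _
      (ofNat_one_ne_two hn))
    exact fun p q hpq => W.cocycle_twistedCycleCommutator_eq_zero hn ht hup hdown hpq
  · have h0 : ∀ p q, p ≠ q → W'.cocycle hn r p q = 0 := fun p q hpq =>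
      W'.cocycle_eq_zero_of_hom hn hr (fun h hh => hW' h ((hg h).2 hh)) hpq
    refine huniv W' ?_ fun ht0 => ?_
    -- The choice `m = n - 1` satisfies `t + 2 ≤ m` because `t + 3 ≤ n`; for nonzero `t`, the choice
    -- `m = 2` below lies in the other range.
    · have := (W'.cocycle_twistedCycleCommutator_one hn (m := n - 1) ht (by omega) (by omega)).1
      rw [if_pos (by omega), h0 _ _ (ofNat_ne (by omega) (by omega))] at this
      exact this.symm
    · have := (W'.cocycle_twistedCycleCommutator_one hn (m := 2) ht le_rfl (by omega)).1
      rw [if_neg (by omega), h0 _ _ (ofNat_ne (by omega) (by omega))] at this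
      exact this.symm

end Universal

/-! ### The target groups and their universal weights -/

section Targets

/-- The homomorphism on a free abelian group with prescribed values on the standard basis. -/
def piLift {k : ℕ} {Q : Type*} [AddCommGroup Q] (x : Fin k → Q) : (Fin k → ℤ) →+ Q :=
  AddMonoidHom.mk' (fun f => ∑ i, f i • x i) fun f g => by
    simp [add_smul, Finset.sum_add_distrib]

theorem piLift_single {k : ℕ} {Q : Type*} [AddCommGroup Q] (x : Fin k → Q) (i : Fin k) :
    piLift x (Pi.single i 1) = x i := by
  simp [piLift, Pi.single_apply]

/-- The homomorphism on `ℤ/k` with a prescribed value at `1`. -/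
def zmodLift (k : ℕ) {Q : Type*} [AddCommGroup Q] (x : Q) (hx : (k : ℤ) • x = 0) : ZMod k →+ Q :=
  ZMod.lift k ⟨zmultiplesHom Q x, by simpa using hx⟩

theorem zmodLift_one (k : ℕ) {Q : Type*} [AddCommGroup Q] (x : Q) (hx : (k : ℤ) • x = 0) :
    zmodLift k x hx 1 = x := by
  have := ZMod.lift_coe k ⟨zmultiplesHom Q x, by simpa using hx⟩ 1
  simpa [zmodLift] using this

theorem single_mem_induction {k : ℕ} {M : Type*} [AddCommGroup M] (ι : (Fin k → ℤ) →+ M)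
    {S : AddSubgroup M} (h : ∀ i, ι (Pi.single i 1) ∈ S) (f : Fin k → ℤ) : ι f ∈ S := by
  have : f = ∑ i, f i • (Pi.single i 1 : Fin k → ℤ) := by
    ext j
    simp [Finset.sum_apply, Pi.single_apply]
  rw [this, map_sum]
  exact S.sum_mem fun i _ => by rw [map_zsmul]; exact S.zsmul_mem (h i) _

theorem zmod_mem_of_one_mem {k : ℕ} {M : Type*} [AddCommGroup M] (ι : ZMod k →+ M)
    {S : AddSubgroup M} (h : ι 1 ∈ S) (z : ZMod k) : ι z ∈ S := by
  obtain ⟨m, rfl⟩ := ZMod.intCast_surjective z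
  rw [← zsmul_one, map_zsmul]
  exact S.zsmul_mem h m

/-- Universal weights. -/
def freeWeights : Weights (Fin 4 → ℤ) :=
  ⟨Pi.single 0 1, Pi.single 1 1, Pi.single 2 1, Pi.single 3 1⟩

theorem freeWeights_generates : freeWeights.Generates := fun S h0 h1 h2 h3 m =>
  single_mem_induction (AddMonoidHom.id _) (S := S) (fun i => by fin_cases i <;> assumption) m

/-- Weights with prescribed values of `upDefect`. -/
def weightsOfDefect {M : Type*} [AddCommGroup M] (n t : ℕ) (far both link defect : M) :
    Weights M :=
  ⟨far, both, link,
    link + ((n : ℤ) - 3 - t) • link + both - ((n : ℤ) - 3 - 2 * t) • far - defect⟩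

section WeightsOfDefect

variable {M N : Type*} [AddCommGroup M] [AddCommGroup N] (n t : ℕ) (far both link defect : M)

theorem upDefect_weightsOfDefect :
    (weightsOfDefect n t far both link defect).upDefect n t = defect := by
  simp only [weightsOfDefect, Weights.upDefect]
  abel

/-- `wind` enters `upDefect` with coefficient -1, so the defect can serve as a coordinate in its
place. -/
theorem weightsOfDefect_upDefect (W : Weights M) :
    weightsOfDefect n t W.far W.both W.link (W.upDefect n t) = W := by
  obtain ⟨x, y, z, w⟩ := W
  simp only [weightsOfDefect, Weights.upDefect, Weights.mk.injEq, true_and]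
  abel

theorem map_weightsOfDefect (L : M →+ N) : (weightsOfDefect n t far both link defect).map L =
    weightsOfDefect n t (L far) (L both) (L link) (L defect) := by
  simp [weightsOfDefect, Weights.map]

theorem downDefect_eq (W : Weights M) :
    W.downDefect n t = W.upDefect n t + (2 : ℤ) • (W.link - W.far - W.both) := by
  simp only [Weights.upDefect, Weights.downDefect]
  module

variable {n t far both link defect} in
theorem defect_mem {S : AddSubgroup M} (h0 : far ∈ S) (h1 : both ∈ S) (h2 : link ∈ S)
    (h3 : (weightsOfDefect n t far both link defect).wind ∈ S) : defect ∈ S := by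
  have := upDefect_weightsOfDefect n t far both link defect
  rw [← this]
  exact S.sub_mem (S.add_mem (S.add_mem (S.sub_mem h2 h3) (S.zsmul_mem h2 _)) h1)
    (S.zsmul_mem h0 _)

end WeightsOfDefect

/-- Universal weights for the cycle commutator. -/
def cycleWeights (n : ℕ) : Weights (ZMod 2 × (Fin 3 → ℤ)) :=
  weightsOfDefect n 0 (0, Pi.single 0 1) (0, Pi.single 1 1) (0, Pi.single 2 1) (1, 0)

theorem cycleWeights_generates (n : ℕ) : (cycleWeights n).Generates := by
  rintro S h0 h1 h2 h3 ⟨z, f⟩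
  have hz := zmod_mem_of_one_mem (AddMonoidHom.inl (ZMod 2) (Fin 3 → ℤ)) (S := S)
    (defect_mem h0 h1 h2 h3) z
  have hf := single_mem_induction (AddMonoidHom.inr (ZMod 2) (Fin 3 → ℤ)) (S := S)
    (fun i => by fin_cases i <;> assumption) f
  simpa using S.add_mem hz hf

/-- Universal weights for the twisted cycle commutators. -/
def twistedWeights (n t : ℕ) : Weights (ZMod 2 × ZMod 4 × (Fin 2 → ℤ)) :=
  weightsOfDefect n t (0, 0, Pi.single 0 1) (0, 0, Pi.single 1 1)
    ((0, 0, Pi.single 0 1) + (0, 0, Pi.single 1 1) + (0, 1, 0)) (1, 0, 0)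

theorem twistedWeights_generates (n t : ℕ) : (twistedWeights n t).Generates := by
  rintro S h0 h1 h2 h3 ⟨z, y, f⟩
  have hz := zmod_mem_of_one_mem (AddMonoidHom.inl (ZMod 2) (ZMod 4 × (Fin 2 → ℤ))) (S := S)
    (defect_mem h0 h1 h2 h3) z
  have hy := zmod_mem_of_one_mem ((AddMonoidHom.inr (ZMod 2) (ZMod 4 × (Fin 2 → ℤ))).comp
    -- The generator of order four is obtained from `link` by removing `far + both`.
    (AddMonoidHom.inl (ZMod 4) (Fin 2 → ℤ))) (S := S)
    ((S.add_mem_cancel_left (S.add_mem h0 h1)).1 h2) y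
  have hf := single_mem_induction ((AddMonoidHom.inr (ZMod 2) (ZMod 4 × (Fin 2 → ℤ))).comp
    (AddMonoidHom.inr (ZMod 4) (Fin 2 → ℤ))) (S := S)
    (fun i => by fin_cases i <;> assumption) f
  simpa using S.add_mem hz (S.add_mem hy hf)

variable {Q : Type*} [AddCommGroup Q]

theorem exists_map_freeWeights (W : Weights Q) : ∃ L : (Fin 4 → ℤ) →+ Q, freeWeights.map L = W := by
  refine ⟨piLift ![W.far, W.both, W.link, W.wind], ?_⟩
  simp [freeWeights, Weights.map, piLift_single]

theorem exists_map_cycleWeights {n : ℕ} (W : Weights Q) (h : (2 : ℤ) • W.upDefect n 0 = 0) :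
    ∃ L : ZMod 2 × (Fin 3 → ℤ) →+ Q, (cycleWeights n).map L = W := by
  refine ⟨(zmodLift 2 (W.upDefect n 0) h).coprod (piLift ![W.far, W.both, W.link]), ?_⟩
  rw [cycleWeights, map_weightsOfDefect]
  refine Eq.trans ?_ (weightsOfDefect_upDefect n 0 W)
  simp [AddMonoidHom.coprod_apply, piLift_single, zmodLift_one]

theorem exists_map_twistedWeights {n t : ℕ} (W : Weights Q) (h : (2 : ℤ) • W.upDefect n t = 0)
    (h' : (2 : ℤ) • W.downDefect n t = 0) :
    ∃ L : ZMod 2 × ZMod 4 × (Fin 2 → ℤ) →+ Q, (twistedWeights n t).map L = W := by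
  -- The defects differ by twice this element, so doubling gives four.
  have h4 : ((4 : ℕ) : ℤ) • (W.link - W.far - W.both) = 0 := by
    rw [downDefect_eq, smul_add, h, zero_add, smul_smul] at h'
    exact h'
  refine ⟨(zmodLift 2 (W.upDefect n t) h).coprod
    ((zmodLift 4 (W.link - W.far - W.both) h4).coprod (piLift ![W.far, W.both])), ?_⟩
  rw [twistedWeights, map_weightsOfDefect]
  refine Eq.trans ?_ (weightsOfDefect_upDefect n t W)
  simp [AddMonoidHom.coprod_apply, piLift_single, zmodLift_one]

theorem two_smul_downDefect_twistedWeights (n t : ℕ) :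
    (2 : ℤ) • (twistedWeights n t).upDefect n t = 0 ∧
    (2 : ℤ) • (twistedWeights n t).downDefect n t = 0 := by
  have h : (2 : ℤ) • (twistedWeights n t).upDefect n t = 0 := by
    rw [twistedWeights, upDefect_weightsOfDefect]
    refine Prod.ext ?_ (Prod.ext ?_ ?_)
    · decide
    · decide
    · simp
  refine ⟨h, ?_⟩
  have e : (twistedWeights n t).link - (twistedWeights n t).far - (twistedWeights n t).both =
      (0, 1, 0) := by
    simp only [twistedWeights, weightsOfDefect]
    abel
  rw [downDefect_eq, smul_add, h, zero_add, e, smul_smul]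
  refine Prod.ext ?_ (Prod.ext ?_ ?_)
  · decide
  · decide
  · simp

end Targets
end PolygonArtin

theorem proposition4p3 (n : ℕ) [NeZero n] (hn : 4 < n) :
    Nonempty (Additive (Abelianization (PolygonArtin.H n)) ≃+ (Fin 4 → ℤ)) ∧
    Nonempty (Additive (Abelianization (PolygonArtin.H0 n)) ≃+ ZMod 2 × (Fin 3 → ℤ)) ∧
    ∀ t : ℕ, 1 ≤ t → t ≤ n - 3 →
      Nonempty (Additive (Abelianization (PolygonArtin.Ht n t)) ≃+
        ZMod 2 × ZMod 4 × (Fin 2 → ℤ)) := by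
  open PolygonArtin in
  refine ⟨?_, ?_, fun t ht1 ht2 => ?_⟩
  · exact freeWeights.nonempty_addEquiv hn (g := MonoidHom.id _) Function.surjective_id
      freeWeights_generates (fun h hh => by rw [show h = 1 from hh, map_one])
      fun W _ => exists_map_freeWeights W
  · have h : Nonempty (Additive (Abelianization (Ht n 0)) ≃+ ZMod 2 × (Fin 3 → ℤ)) := by
      refine (cycleWeights n).nonempty_addEquiv_quotient hn (by omega) (cycleWeights_generates n)
        ?_ (fun h => absurd rfl h) fun W h _ => exists_map_cycleWeights W h
      rw [cycleWeights, upDefect_weightsOfDefect]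
      refine Prod.ext ?_ ?_
      · decide
      · simp
    -- The relator occurs in the type of the quotient, so the equality of the two commutators is
    -- transported by generalising over `r`.
    have key : ∀ r, r = twistedCycleCommutator n 0 (a n) →
        Nonempty (Additive (Abelianization
          ((H n).map (QuotientGroup.mk' (Subgroup.normalClosure {r})))) ≃+
            ZMod 2 × (Fin 3 → ℤ)) := by
      rintro _ rfl
      exact h
    exact key _ cycleCommutator_eq
  · have h := two_smul_downDefect_twistedWeights n t
    exact (twistedWeights n t).nonempty_addEquiv_quotient hn (by omega)
      (twistedWeights_generates n t) h.1 (fun _ => h.2)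
      fun W hup hdown => exists_map_twistedWeights W hup (hdown (by omega))
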